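/- Let $k$ be a field, $H$ a finite-dimensional Hopf algebra over $k$ with comultiplication $\Delta$, counit $\varepsilon$ and antipode $S$, and $R\subseteq H$ a Hopf subalgebra (a unital subalgebra with $\Delta(R)\subseteq R\otimes R$ and $S(R)\subseteq R$). Put $R^+=R\cap\ker\varepsilon$ and let $V=H/R^+H$, a right $H$-module and, by restriction, a right $R$-module. *Similarity.* For modules $M,N$ over a ring write $M\mid qN$ if $M$ is isomorphic to a direct summand of the direct sum of $q$ copies of $N$; $M\sim N$ means $M\mid qN$ and $N\mid rM$ for some $q,r\in\mathbb N$. *Subalgebra depth.* For a subalgebra $B\subseteq A$ let $A^{\otimes_B n}=A\otimes_B\cdots\otimes_B A$ ($n$ factors, $n\ge 1$) and $A^{\otimes_B 0}=B$. The subalgebra $B\subseteq A$ has depth $2n+1$ ($n\ge 0$) if $A^{\otimes_B(n+1)}\sim A^{\otimes_B n}$ as $B$-$B$-bimodules; depth $2n$ ($n\ge 1$) if $A^{\otimes_B(n+1)}\sim A^{\otimes_B n}$ as $B$-$A$-bimodules or as $A$-$B$-bimodules; h-depth $2n-1$ ($n\ge 1$) if $A^{\otimes_B(n+1)}\sim A^{\otimes_B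 n}$ as $A$-$A$-bimodules. Let $d(B,A)$ and $d_h(B,A)$ be the least depth and the least h-depth ($\infty$ if there is none), and let $d_{\mathrm{even}}(B,A)=2\lceil d(B,A)/2\rceil$ be the least even number $\ge d(B,A)$ ($\infty$ if $d(B,A)=\infty$). *Module depth.* For $L\in\{R,H\}$ let $\mathcal M_L$ be the tensor category of finite-dimensional right $L$-modules, with $(u\otimes w)h=\sum uh_{(1)}\otimes wh_{(2)}$ and unit object $k_\varepsilon$. For $W\in\mathcal M_L$ nonzero put $T_0(W)=k_\varepsilon$ and $T_n(W)=W\oplus W^{\otimes 2}\oplus\cdots\oplus W^{\otimes n}$ for $n\ge1$. Then $W$ has depth $n\ge 0$ in $\mathcal M_L$ if $T_{n+1}(W)\mid q\,T_n(W)$ for some $q\in\mathbb N$; $d(W,\mathcal M_L)$ is the least such $n$ ($\infty$ if there is none). **Theorem.** In $\mathbb N\cup\{\infty\}$, $$d_{\mathrm{even}}(R,H)=2\,d(V,\mathcal M_R)+2,\qquad d_h(R,H)=2\,d(V,\mathcal M_H)+1,$$ and consequently $$2\,d(V,\mathcal M_R)+1\ \le\ d(R,H)\ \le\ 2\,d(V,\mathcal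 M_R)+2 .$$ -/

import Mathlib

open scoped TensorProduct
open MulOpposite

universe u

noncomputable section

namespace HopfDepth

/-! ### Similarity of modules -/

section Similarity

variable (E : Type*) [Ring E] (M N : Type*) [AddCommGroup M] [Module E M]
  [AddCommGroup N] [Module E N]

/-- `M` divides a multiple of `N`: `M` is isomorphic to a direct summand of a finite direct sum
`N ⊕ ⋯ ⊕ N` of `q` copies of `N`. -/
def DividesMultiple : Prop :=
  ∃ (q : ℕ) (P Q : Submodule E (Fin q → N)), IsCompl P Q ∧ Nonempty (M ≃ₗ[E] P)

/-- Similarity of modules: each divides a multiple of the other. -/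
def Similar : Prop :=
  DividesMultiple E M N ∧ DividesMultiple E N M

end Similarity

/-! ### Bimodules over `k`-algebras -/

section Bimodules

variable (k : Type u) [Field k]

/-- An `X`-`Y`-bimodule over the field `k`: a `k`-vector space with a left action of `X` and a
right action of `Y` (a left action of `Yᵐᵒᵖ`) that commute; `k` acts centrally. -/
structure Bimodule (X Y : Type u) [Ring X] [Algebra k X] [Ring Y] [Algebra k Y] where
  carrier : Type u
  [addCommGroup : AddCommGroup carrier]
  [module : Module k carrier]
  left : X →ₐ[k] Module.End k carrier
  right : Yᵐᵒᵖ →ₐ[k] Module.End k carrier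
  comm : ∀ x y, Commute (left x) (right y)

attribute [instance] Bimodule.addCommGroup Bimodule.module

variable {k}

/-- The algebra map `E → End (M ⧸ P)` induced by `f : E → End M` on the quotient by an
invariant subspace `P`. -/
def quotientAction {E M : Type*} [Ring E] [Algebra k E] [AddCommGroup M] [Module k M]
    (f : E →ₐ[k] Module.End k M) (P : Submodule k M) (h : ∀ e, P ≤ P.comap (f e)) :
    E →ₐ[k] Module.End k (M ⧸ P) :=
  AlgHom.ofLinearMap
    { toFun := fun e => P.mapQ P (f e) (h e)
      map_add' := fun a b => by
        apply Submodule.linearMap_qext; ext m; simp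
      map_smul' := fun c a => by
        apply Submodule.linearMap_qext; ext m; simp }
    (by apply Submodule.linearMap_qext; ext m; simp)
    (fun a b => by apply Submodule.linearMap_qext; ext m; simp)

namespace Bimodule

variable {X Y B : Type u} [Ring X] [Algebra k X] [Ring Y] [Algebra k Y]
  [Ring B] [Algebra k B]

/-- `X`-`Y`-bimodules are modules over `X ⊗ Yᵐᵒᵖ`, with `(x ⊗ y) m = x m y`. -/
instance (M : Bimodule k X Y) : Module (X ⊗[k] Yᵐᵒᵖ) M.carrier :=
  Module.compHom M.carrier (Algebra.TensorProduct.lift M.left M.right M.comm).toRingHom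

variable (k) in
/-- The regular bimodule `X` over itself. -/
def regular (X : Type u) [Ring X] [Algebra k X] : Bimodule k X X where
  carrier := X
  left := Algebra.lsmul k k X
  right := Algebra.lsmul k k X
  comm _ _ := by ext m; simp [mul_assoc]

/-- Restriction of a bimodule along algebra maps on both sides. -/
def restrict {X' Y' : Type u} [Ring X'] [Algebra k X'] [Ring Y'] [Algebra k Y']
    (M : Bimodule k X Y) (f : X' →ₐ[k] X) (g : Y' →ₐ[k] Y) : Bimodule k X' Y' where
  carrier := M.carrier
  left := M.left.comp f
  right := M.right.comp (AlgHom.op g)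
  comm _ _ := M.comm _ _

/-- The subspace of `M ⊗ N` spanned by all `m b ⊗ n - m ⊗ b n`. -/
def balancing (M : Bimodule k X B) (N : Bimodule k B Y) :
    Submodule k (M.carrier ⊗[k] N.carrier) :=
  Submodule.span k {t | ∃ (m : M.carrier) (b : B) (n : N.carrier),
    t = M.right (op b) m ⊗ₜ[k] n - m ⊗ₜ[k] N.left b n}

/-- The tensor product `M ⊗_B N` over the (not necessarily commutative) algebra `B`,
an `X`-`Y`-bimodule by `x (m ⊗ n) y = x m ⊗ n y`. -/
def tensor (M : Bimodule k X B) (N : Bimodule k B Y) : Bimodule k X Y where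
  carrier := (M.carrier ⊗[k] N.carrier) ⧸ balancing M N
  left := quotientAction ((Module.End.rTensorAlgHom k M.carrier N.carrier).comp M.left)
    (balancing M N) (fun x => by
      refine Submodule.span_le.2 ?_
      rintro _ ⟨m, b, n, rfl⟩
      refine Submodule.subset_span ⟨M.left x m, b, n, ?_⟩
      have h : M.left x (M.right (op b) m) = M.right (op b) (M.left x m) :=
        LinearMap.congr_fun (M.comm x (op b)) m
      refine (map_sub _ _ _).trans ?_
      change M.left x (M.right (op b) m) ⊗ₜ[k] n - M.left x m ⊗ₜ[k] N.left b n = _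
      rw [h])
  right := quotientAction ((Module.End.lTensorAlgHom k N.carrier M.carrier).comp N.right)
    (balancing M N) (fun y => by
      refine Submodule.span_le.2 ?_
      rintro _ ⟨m, b, n, rfl⟩
      refine Submodule.subset_span ⟨m, b, N.right y n, ?_⟩
      have h : N.left b (N.right y n) = N.right y (N.left b n) :=
        LinearMap.congr_fun (N.comm b y) n
      refine (map_sub _ _ _).trans ?_
      change M.right (op b) m ⊗ₜ[k] N.right y n - m ⊗ₜ[k] N.right y (N.left b n) = _
      rw [h])
  comm x y := by
    apply Submodule.linearMap_qext
    apply TensorProduct.ext'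
    intro m n
    rfl

end Bimodule

end Bimodules

/-! ### Depth and h-depth of a subalgebra -/

section SubalgebraDepth

variable {k : Type u} [Field k] {A : Type u} [Ring A] [Algebra k A] (B : Subalgebra k A)

/-- `tensorPower B n` is the `A`-`A`-bimodule `A ⊗_B ⋯ ⊗_B A` with `n + 1` factors `A`. -/
def tensorPower : ℕ → Bimodule k A A
  | 0 => Bimodule.regular k A
  | n + 1 => ((tensorPower n).restrict (AlgHom.id k A) B.val).tensor
      ((Bimodule.regular k A).restrict B.val (AlgHom.id k A))

/-- The `n`-th tensor power of `A` over `B` as a `B`-`B`-bimodule, the zeroth one being `B`. -/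
def tensorPowerBB : ℕ → Bimodule k B B
  | 0 => Bimodule.regular k B
  | n + 1 => (tensorPower B n).restrict B.val B.val

/-- Depth `2 n + 1` for `n ≥ 0`: the tensor powers of `A` over `B` with `n + 1` and `n` factors
are similar as `B`-`B`-bimodules. -/
def HasOddDepth (n : ℕ) : Prop :=
  Similar (B ⊗[k] Bᵐᵒᵖ) (tensorPowerBB B (n + 1)).carrier (tensorPowerBB B n).carrier

/-- Left depth `2 (n + 1)`: the tensor powers of `A` over `B` with `n + 2` and `n + 1` factors
are similar as `B`-`A`-bimodules. -/
def HasLeftDepth (n : ℕ) : Prop :=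
  Similar (B ⊗[k] Aᵐᵒᵖ) ((tensorPower B (n + 1)).restrict B.val (AlgHom.id k A)).carrier
    ((tensorPower B n).restrict B.val (AlgHom.id k A)).carrier

/-- Right depth `2 (n + 1)`: the tensor powers of `A` over `B` with `n + 2` and `n + 1` factors
are similar as `A`-`B`-bimodules. -/
def HasRightDepth (n : ℕ) : Prop :=
  Similar (A ⊗[k] Bᵐᵒᵖ) ((tensorPower B (n + 1)).restrict (AlgHom.id k A) B.val).carrier
    ((tensorPower B n).restrict (AlgHom.id k A) B.val).carrier

/-- The subalgebra `B ⊆ A` has depth `d ≥ 1`. Even depth means left or right even depth. -/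
def HasDepth (d : ℕ) : Prop :=
  (∃ n, d = 2 * n + 1 ∧ HasOddDepth B n) ∨
    (∃ n, d = 2 * (n + 1) ∧ (HasLeftDepth B n ∨ HasRightDepth B n))

/-- The subalgebra `B ⊆ A` has h-depth `d = 2 (n + 1) - 1 = 2 n + 1`: the tensor powers of `A`
over `B` with `n + 2` and `n + 1` factors are similar as `A`-`A`-bimodules. -/
def HasHDepth (d : ℕ) : Prop :=
  ∃ n, d = 2 * n + 1 ∧
    Similar (A ⊗[k] Aᵐᵒᵖ) (tensorPower B (n + 1)).carrier (tensorPower B n).carrier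

/-- The minimum depth `d(B, A)`, equal to `⊤` if there is no finite depth. -/
def minDepth : ℕ∞ := ⨅ (d : ℕ) (_ : HasDepth B d), (d : ℕ∞)

/-- The minimum h-depth `d_h(B, A)`, equal to `⊤` if there is no finite h-depth. -/
def minHDepth : ℕ∞ := ⨅ (d : ℕ) (_ : HasHDepth B d), (d : ℕ∞)

/-- The least even number greater than or equal to `d(B, A)`; it is `⊤` iff `d(B, A) = ⊤`. -/
def minEvenDepth : ℕ∞ := sInf {m : ℕ∞ | Even m ∧ minDepth B ≤ m}

end SubalgebraDepth

/-! ### Right modules over a bialgebra, their tensor products and depth -/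

section ModuleDepth

variable (k : Type u) [Field k]

/-- A right module over the `k`-algebra `H`, i.e. a left module over `Hᵐᵒᵖ`. -/
structure RightModule (H : Type u) [Ring H] [Algebra k H] where
  carrier : Type u
  [addCommGroup : AddCommGroup carrier]
  [module : Module k carrier]
  act : Hᵐᵒᵖ →ₐ[k] Module.End k carrier

attribute [instance] RightModule.addCommGroup RightModule.module

namespace RightModule

variable {k}

section Algebra

variable {H : Type u} [Ring H] [Algebra k H]

instance (W : RightModule k H) : Module Hᵐᵒᵖ W.carrier :=
  Module.compHom W.carrier W.act.toRingHom

instance (W : RightModule k H) : IsScalarTower k Hᵐᵒᵖ W.carrier :=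
  ⟨fun c h w => by
    change W.act (c • h) w = c • W.act h w
    simp⟩

variable (k H) in
/-- Bundling of a right module. -/
def of (W : Type u) [AddCommGroup W] [Module k W] [Module Hᵐᵒᵖ W] [IsScalarTower k Hᵐᵒᵖ W] :
    RightModule k H where
  carrier := W
  act := Algebra.lsmul k k W

/-- Restriction of a right module along an algebra map. -/
def restrict {H' : Type u} [Ring H'] [Algebra k H'] (W : RightModule k H) (f : H' →ₐ[k] H) :
    RightModule k H' where
  carrier := W.carrier
  act := W.act.comp (AlgHom.op f)

end Algebra

variable {H : Type u} [Ring H] [Bialgebra k H]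

variable (k H) in
/-- The unit module: `k` with `H` acting through the counit. -/
def unit : RightModule k H where
  carrier := k
  act := (Algebra.ofId k (Module.End k k)).comp
    (AlgHom.fromOpposite (Bialgebra.counitAlgHom k H) fun _ _ => Commute.all _ _)

/-- The tensor product of right `H`-modules with the diagonal action
`(u ⊗ w) h = ∑ u h₍₁₎ ⊗ w h₍₂₎`. -/
def tensor (U W : RightModule k H) : RightModule k H where
  carrier := U.carrier ⊗[k] W.carrier
  act := ((Module.endTensorEndAlgHom (R := k) (S := k) (A := k)).comp
    (Algebra.TensorProduct.map U.act W.act)).comp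
      ((Algebra.TensorProduct.opAlgEquiv k k H H).symm.toAlgHom.comp
        (AlgHom.op (Bialgebra.comulAlgHom k H)))

/-- The tensor powers of `W`; the zeroth one is the unit module. -/
def tpow (W : RightModule k H) : ℕ → RightModule k H
  | 0 => unit k H
  | n + 1 => (W.tpow n).tensor W

/-- The truncated tensor algebra: the direct sum of the tensor powers of `W` of degrees
`1, …, n` if `n ≥ 1`, and the unit module if `n = 0`. -/
def truncated (W : RightModule k H) : ℕ → RightModule k H
  | 0 => unit k H
  | n + 1 => of k H (∀ i : Fin (n + 1), (W.tpow (i + 1)).carrier)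

/-- `W` has depth `n` in the tensor category of right `H`-modules. -/
def HasModuleDepth (W : RightModule k H) (n : ℕ) : Prop :=
  DividesMultiple Hᵐᵒᵖ (W.truncated (n + 1)).carrier (W.truncated n).carrier

/-- The minimum depth of `W` in the tensor category of right `H`-modules, equal to `⊤` if `W`
has no finite depth. -/
def depth (W : RightModule k H) : ℕ∞ := ⨅ (n : ℕ) (_ : W.HasModuleDepth n), (n : ℕ∞)

end RightModule

end ModuleDepth

/-! ### Hopf subalgebras -/

section HopfSubalgebras

variable (k : Type u) [Field k] (H : Type u) [Ring H] [HopfAlgebra k H]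

/-- A Hopf subalgebra: a unital subalgebra `R` with `Δ(R) ⊆ R ⊗ R` and `S(R) ⊆ R`. -/
structure HopfSubalgebra extends Subalgebra k H where
  comul_mem : ∀ r ∈ toSubalgebra, Coalgebra.comul (R := k) r ∈
    (Algebra.TensorProduct.map toSubalgebra.val toSubalgebra.val).range
  antipode_mem : ∀ r ∈ toSubalgebra, HopfAlgebra.antipode k r ∈ toSubalgebra

namespace HopfSubalgebra

variable {k H} (R : HopfSubalgebra k H)

/-- The canonical map `R ⊗ R → H ⊗ H`. -/
def incl₂ : R.toSubalgebra ⊗[k] R.toSubalgebra →ₐ[k] H ⊗[k] H :=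
  Algebra.TensorProduct.map R.toSubalgebra.val R.toSubalgebra.val

lemma incl₂_tmul (x y : R.toSubalgebra) : R.incl₂ (x ⊗ₜ[k] y) = (x : H) ⊗ₜ[k] (y : H) := rfl

lemma incl₂_injective : Function.Injective R.incl₂ :=
  TensorProduct.map_injective_of_flat_flat _ _ Subtype.val_injective Subtype.val_injective

/-- The comultiplication of `H` restricted to `R → R ⊗ R`. -/
def comulHom : R.toSubalgebra →ₐ[k] R.toSubalgebra ⊗[k] R.toSubalgebra :=
  (AlgEquiv.ofInjective R.incl₂ R.incl₂_injective).symm.toAlgHom.comp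
    (((Bialgebra.comulAlgHom k H).comp R.toSubalgebra.val).codRestrict R.incl₂.range
      fun r => R.comul_mem r r.2)

lemma incl₂_comulHom (r : R.toSubalgebra) :
    R.incl₂ (R.comulHom r) = Coalgebra.comul (R := k) (r : H) :=
  congrArg Subtype.val ((AlgEquiv.ofInjective R.incl₂ R.incl₂_injective).apply_symm_apply
    ⟨Coalgebra.comul (R := k) (r : H), R.comul_mem r r.2⟩)

/-- `R` is a bialgebra with the structure restricted from `H`. -/
instance : Bialgebra k R.toSubalgebra :=
  Bialgebra.ofAlgHom R.comulHom ((Bialgebra.counitAlgHom k H).comp R.toSubalgebra.val)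
    (by
      ext r
      have hinj : Function.Injective
          (Algebra.TensorProduct.map R.toSubalgebra.val R.incl₂) :=
        TensorProduct.map_injective_of_flat_flat _ _ Subtype.val_injective R.incl₂_injective
      apply hinj
      have h₁ (t : R.toSubalgebra ⊗[k] R.toSubalgebra) :
          Algebra.TensorProduct.map R.toSubalgebra.val R.incl₂
            (Algebra.TensorProduct.assoc k k k _ _ _
              (Algebra.TensorProduct.map R.comulHom (.id k _) t)) =
          TensorProduct.assoc k H H H (Coalgebra.comul.rTensor H (R.incl₂ t)) := by
        induction t with
        | zero => simp
        | add x y hx hy => simp only [map_add, hx, hy]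
        | tmul x y =>
          have h (s : R.toSubalgebra ⊗[k] R.toSubalgebra) :
              Algebra.TensorProduct.map R.toSubalgebra.val R.incl₂
                (Algebra.TensorProduct.assoc k k k _ _ _ (s ⊗ₜ[k] y)) =
              TensorProduct.assoc k H H H (R.incl₂ s ⊗ₜ[k] (y : H)) := by
            induction s with
            | zero => simp
            | add a b ha hb => simp only [map_add, TensorProduct.add_tmul, ha, hb]
            | tmul a b => simp [incl₂_tmul]
          simpa [incl₂_comulHom, incl₂_tmul] using h (R.comulHom x)
      have h₂ (t : R.toSubalgebra ⊗[k] R.toSubalgebra) :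
          Algebra.TensorProduct.map R.toSubalgebra.val R.incl₂
            (Algebra.TensorProduct.map (.id k _) R.comulHom t) =
          Coalgebra.comul.lTensor H (R.incl₂ t) := by
        induction t with
        | zero => simp
        | add x y hx hy => simp only [map_add, hx, hy]
        | tmul x y => simp [incl₂_comulHom, incl₂_tmul]
      refine (h₁ _).trans (Eq.trans ?_ (h₂ _).symm)
      erw [incl₂_comulHom]
      exact Coalgebra.coassoc_apply (R := k) (r : H))
    (by
      ext r
      have hinj : Function.Injective
          (Algebra.TensorProduct.map (.id k k) R.toSubalgebra.val) :=
        TensorProduct.map_injective_of_flat_flat _ _ Function.injective_id Subtype.val_injective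
      apply hinj
      have h (t : R.toSubalgebra ⊗[k] R.toSubalgebra) :
          Algebra.TensorProduct.map (.id k k) R.toSubalgebra.val (Algebra.TensorProduct.map
            ((Bialgebra.counitAlgHom k H).comp R.toSubalgebra.val) (.id k _) t) =
          Coalgebra.counit.rTensor H (R.incl₂ t) := by
        induction t with
        | zero => simp
        | add x y hx hy => simp only [map_add, hx, hy]
        | tmul x y => simp [incl₂_tmul]
      refine (h _).trans ?_
      erw [incl₂_comulHom, Coalgebra.rTensor_counit_comul]
      simp)
    (by
      ext r
      have hinj : Function.Injective
          (Algebra.TensorProduct.map R.toSubalgebra.val (.id k k)) :=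
        TensorProduct.map_injective_of_flat_flat _ _ Subtype.val_injective Function.injective_id
      apply hinj
      have h (t : R.toSubalgebra ⊗[k] R.toSubalgebra) :
          Algebra.TensorProduct.map R.toSubalgebra.val (.id k k) (Algebra.TensorProduct.map
            (.id k _) ((Bialgebra.counitAlgHom k H).comp R.toSubalgebra.val) t) =
          Coalgebra.counit.lTensor H (R.incl₂ t) := by
        induction t with
        | zero => simp
        | add x y hx hy => simp only [map_add, hx, hy]
        | tmul x y => simp [incl₂_tmul]
      refine (h _).trans ?_
      erw [incl₂_comulHom, Coalgebra.lTensor_counit_comul]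
      simp)

/-- The right ideal `R⁺H` of `H` generated by `R⁺ = R ∩ ker ε`. -/
def augIdeal : Submodule Hᵐᵒᵖ H :=
  Submodule.span Hᵐᵒᵖ {r : H | r ∈ R.toSubalgebra ∧ Coalgebra.counit (R := k) r = 0}

/-- The generalized permutation module `V = H / R⁺H`, a right `H`-module. -/
def permModule : RightModule k H := RightModule.of k H (H ⧸ R.augIdeal)

end HopfSubalgebra

end HopfSubalgebras

end HopfDepth

end

open scoped TensorProduct
open MulOpposite

noncomputable section

namespace HopfDepth

/-! ### Divisibility and similarity of modules -/

section Similarity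

variable {E : Type*} [Ring E] {M N P : Type*} [AddCommGroup M] [Module E M]
  [AddCommGroup N] [Module E N] [AddCommGroup P] [Module E P]

/-! The bridge between the two kinds of depth is the isomorphism `M ⊗_R H ≅ M ⊗ V`, m ⊗ h ↦ ∑ m h₁ ⊗
[h₂] (`galoisIso`): the shear m ⊗ h ↦ ∑ m h₁ ⊗ h₂ of M ⊗ H is invertible thanks to the antipode and
carries the relations of ⊗_R onto M ⊗ R⁺H. By iteration the (n+1)-fold tensor power of H over R
becomes H ⊗ V^{⊗n}, with H acting on the left of the first factor and diagonally on the right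
(`tensorPowerIso`).

The functor W ↦ H ⊗ W is additive and is undone by killing H⁺ on the left. For L = R or L = H,
similarity of H ⊗ W and H ⊗ W' as H-L-bimodules is therefore similarity of W and W' over L
(`similar_free_iff`). Moreover V is a coalgebra in the module category, so V^{⊗n} is a summand of
V^{⊗(n+1)} for n ≥ 1, and module depth n just means V^{⊗(n+1)} ~ V^{⊗n} (`hasModuleDepth_iff`,
`hasModuleDepth_restrict_iff`). Taking L = H gives the h-depth formula; taking L = R shows that
right depth 2n+2 is module depth n over R, which is the upper bound.

For the lower bound, every other depth condition must also yield module depth. From odd depth,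
killing R⁺ on the left turns H ⊗ V^{⊗m} into V^{⊗(m+1)} and R into k
(`hasModuleDepth_of_hasOddDepth`). From left depth, killing H⁺ on the right turns H ⊗ W into W
through h ⊗ w ↦ w S⁻¹(h) (`hasModuleDepth_of_hasLeftDepth`). This last step needs S to be bijective,
and is where finite dimension enters: `antipode_injective` obtains it from a nonzero integral
constructed as a trace. The even depth formula then follows by parity. -/

lemma DividesMultiple.of_sum_eq_id {ι : Type*} [Fintype ι] (f : ι → M →ₗ[E] N)
    (g : ι → N →ₗ[E] M) (h : ∀ m, ∑ i, g i (f i m) = m) : DividesMultiple E M N := by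
  let e := Fintype.equivFin ι
  let F : M →ₗ[E] (Fin (Fintype.card ι) → N) := LinearMap.pi fun j => f (e.symm j)
  let G : (Fin (Fintype.card ι) → N) →ₗ[E] M := ∑ j, g (e.symm j) ∘ₗ LinearMap.proj j
  have hGF (m : M) : G (F m) = m := by
    simp only [G, F, LinearMap.sum_apply, LinearMap.comp_apply, LinearMap.proj_apply,
      LinearMap.pi_apply]
    exact (e.symm.sum_comp fun i => g i (f i m)).trans (h m)
  -- Since G F = 1, the map F G is idempotent, with image `range F` and kernel `ker G`.
  refine ⟨Fintype.card ι, LinearMap.range F, LinearMap.ker G, ⟨?_, ?_⟩,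
    ⟨LinearEquiv.ofInjective F fun a b hab => by rw [← hGF a, hab, hGF]⟩⟩
  · rw [Submodule.disjoint_def]
    rintro _ ⟨m, rfl⟩ hm
    rw [LinearMap.mem_ker, hGF] at hm
    rw [hm, map_zero]
  · rw [codisjoint_iff, eq_top_iff]
    intro x _
    refine Submodule.mem_sup.2 ⟨F (G x), ⟨_, rfl⟩, x - F (G x), ?_, by abel⟩
    rw [LinearMap.mem_ker, map_sub, hGF, sub_self]

/-- Written as an identity ∑ gᵢ fᵢ = 1, divisibility is preserved by every additive functor; all
later transfers use this form. -/
lemma DividesMultiple.exists_sum_eq_id (h : DividesMultiple E M N) :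
    ∃ (q : ℕ) (f : Fin q → M →ₗ[E] N) (g : Fin q → N →ₗ[E] M),
      ∀ m, ∑ i, g i (f i m) = m := by
  obtain ⟨q, A, B, hAB, ⟨e⟩⟩ := h
  let p := A.projectionOnto B hAB
  refine ⟨q, fun i => LinearMap.proj i ∘ₗ A.subtype ∘ₗ e.toLinearMap,
    fun i => e.symm.toLinearMap ∘ₗ p ∘ₗ LinearMap.single E (fun _ => N) i, fun m => ?_⟩
  simp only [LinearMap.comp_apply, ← map_sum, LinearEquiv.coe_coe]
  have : ∑ i, LinearMap.single E (fun _ => N) i ((LinearMap.proj (R := E) i) (A.subtype (e m))) =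
      A.subtype (e m) := by
    ext j
    simp [Finset.sum_apply, Pi.single_apply]
  rw [this]
  simp [p]

lemma DividesMultiple.of_retract (f : M →ₗ[E] N) (g : N →ₗ[E] M) (h : ∀ m, g (f m) = m) :
    DividesMultiple E M N :=
  .of_sum_eq_id (ι := Unit) (fun _ => f) (fun _ => g) (by simpa using h)

lemma DividesMultiple.of_equiv (e : M ≃ₗ[E] N) : DividesMultiple E M N :=
  .of_retract e.toLinearMap e.symm.toLinearMap (by simp)

lemma DividesMultiple.trans (h₁ : DividesMultiple E M N) (h₂ : DividesMultiple E N P) :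
    DividesMultiple E M P := by
  obtain ⟨q, f, g, h⟩ := h₁.exists_sum_eq_id
  obtain ⟨q', f', g', h'⟩ := h₂.exists_sum_eq_id
  refine .of_sum_eq_id (ι := Fin q × Fin q') (fun i => f' i.2 ∘ₗ f i.1)
    (fun i => g i.1 ∘ₗ g' i.2) fun m => ?_
  simp only [LinearMap.comp_apply, Fintype.sum_prod_type, ← map_sum, h', h]

lemma DividesMultiple.pi {ι : Type*} [Fintype ι] [DecidableEq ι] {M : ι → Type*}
    [∀ i, AddCommGroup (M i)] [∀ i, Module E (M i)] (h : ∀ i, DividesMultiple E (M i) N) :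
    DividesMultiple E (∀ i, M i) N := by
  choose q f g hfg using fun i => (h i).exists_sum_eq_id
  refine .of_sum_eq_id (ι := Σ i, Fin (q i)) (fun i => f i.1 i.2 ∘ₗ LinearMap.proj i.1)
    (fun i => LinearMap.single E M i.1 ∘ₗ g i.1 i.2) fun m => ?_
  have (i : ι) : ∑ j, LinearMap.single E M i (g i j (f i j (m i))) = Pi.single i (m i) := by
    rw [← map_sum, hfg, LinearMap.single_apply]
  simp only [LinearMap.comp_apply, Fintype.sum_sigma, LinearMap.proj_apply, this]
  exact Finset.univ_sum_single m

lemma DividesMultiple.of_pi_right {ι : Type*} [DecidableEq ι] {M : ι → Type*}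
    [∀ i, AddCommGroup (M i)] [∀ i, Module E (M i)] (i : ι) :
    DividesMultiple E (M i) (∀ i, M i) :=
  .of_retract (LinearMap.single E M i) (LinearMap.proj i) (by simp)

lemma Similar.symm (h : Similar E M N) : Similar E N M := ⟨h.2, h.1⟩

lemma Similar.trans (h₁ : Similar E M N) (h₂ : Similar E N P) : Similar E M P :=
  ⟨h₁.1.trans h₂.1, h₂.2.trans h₁.2⟩

lemma Similar.of_equiv (e : M ≃ₗ[E] N) : Similar E M N := ⟨.of_equiv e, .of_equiv e.symm⟩

lemma similar_congr {M' N' : Type*} [AddCommGroup M'] [Module E M'] [AddCommGroup N']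
    [Module E N'] (e : M ≃ₗ[E] M') (e' : N ≃ₗ[E] N') : Similar E M N ↔ Similar E M' N' :=
  ⟨fun h => ((Similar.of_equiv e).symm.trans h).trans (.of_equiv e'),
    fun h => ((Similar.of_equiv e).trans h).trans (Similar.of_equiv e').symm⟩

end Similarity

/-! ### Passing to coinvariants -/

section Coinvariants

variable {E E' : Type*} [Ring E] [Ring E'] {N N' W W' : Type*} [AddCommGroup N] [Module E N]
  [AddCommGroup N'] [Module E N'] [AddCommGroup W] [Module E' W] [AddCommGroup W'] [Module E' W']

/-- `π` exhibits the `E'`-module `W` as the quotient `N / I N` of the `E`-module `N`, where `E'`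
acts through the map `σ`. -/
structure IsCoinvariants (σ : E' → E) (I : Set E) (π : N →+ W) : Prop where
  surjective : Function.Surjective π
  map_smul : ∀ e n, π (σ e • n) = e • π n
  map_eq_zero : ∀ i ∈ I, ∀ n, π (i • n) = 0
  mem_closure : ∀ n, π n = 0 → n ∈ AddSubgroup.closure {m | ∃ i ∈ I, ∃ n', m = i • n'}

namespace IsCoinvariants

variable {σ : E' → E} {I : Set E} {π : N →+ W} {π' : N' →+ W'}

/-- A linear map sends I N into I N', so it descends to the quotients; this makes `desc` well
defined. -/
lemma apply_eq_zero (h : IsCoinvariants σ I π) (h' : IsCoinvariants σ I π') (f : N →ₗ[E] N')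
    {n : N} (hn : π n = 0) : π' (f n) = 0 := by
  have := h.mem_closure n hn
  induction this using AddSubgroup.closure_induction with
  | mem x hx =>
    obtain ⟨i, hi, m, rfl⟩ := hx
    rw [_root_.map_smul]
    exact h'.map_eq_zero i hi _
  | zero => simp
  | add x y hx hy hx' hy' =>
    -- The induction hypotheses ask for `π` to vanish at each summand separately; it vanishes on the
    -- whole closure.
    have key : ∀ z ∈ AddSubgroup.closure {m | ∃ i ∈ I, ∃ n' : N, m = i • n'}, π z = 0 := by
      intro z hz
      induction hz using AddSubgroup.closure_induction with
      | mem x hx => obtain ⟨i, hi, m, rfl⟩ := hx; exact h.map_eq_zero i hi _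
      | zero => simp
      | add x y _ _ hx hy => rw [map_add, hx, hy, add_zero]
      | neg x _ hx => rw [map_neg, hx, neg_zero]
    rw [map_add, map_add, hx' (key x hx), hy' (key y hy), add_zero]
  | neg x hx hx' =>
    rw [map_neg, map_neg, hx' (by simpa using hn), neg_zero]

/-- The map induced on coinvariants. -/
def desc (h : IsCoinvariants σ I π) (h' : IsCoinvariants σ I π') (f : N →ₗ[E] N') :
    W →ₗ[E'] W' :=
  have key {n m : N} (hnm : π n = π m) : π' (f n) = π' (f m) := by
    rw [← sub_eq_zero, ← map_sub, ← map_sub]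
    exact h.apply_eq_zero h' f (by rw [map_sub, hnm, sub_self])
  { toFun := fun w => π' (f (Function.surjInv h.surjective w))
    map_add' := fun a b => by
      rw [← map_add, ← map_add]
      apply key
      simp [Function.surjInv_eq]
    map_smul' := fun e a => by
      rw [RingHom.id_apply, ← h'.map_smul, ← _root_.map_smul]
      apply key
      simp [Function.surjInv_eq, h.map_smul] }

lemma desc_apply (h : IsCoinvariants σ I π) (h' : IsCoinvariants σ I π') (f : N →ₗ[E] N') (n : N) :
    h.desc h' f (π n) = π' (f n) := by
  change π' (f _) = _
  rw [← sub_eq_zero, ← map_sub, ← map_sub]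
  exact h.apply_eq_zero h' f (by rw [map_sub, Function.surjInv_eq h.surjective, sub_self])

lemma dividesMultiple (h : IsCoinvariants σ I π) (h' : IsCoinvariants σ I π')
    (hd : DividesMultiple E N N') : DividesMultiple E' W W' := by
  obtain ⟨q, f, g, hfg⟩ := hd.exists_sum_eq_id
  refine .of_sum_eq_id (fun i => h.desc h' (f i)) (fun i => h'.desc h (g i)) fun w => ?_
  obtain ⟨n, rfl⟩ := h.surjective w
  simp only [desc_apply, ← map_sum, hfg]

lemma similar (h : IsCoinvariants σ I π) (h' : IsCoinvariants σ I π')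
    (hs : Similar E N N') : Similar E' W W' :=
  ⟨h.dividesMultiple h' hs.1, h'.dividesMultiple h hs.2⟩

end IsCoinvariants

end Coinvariants

/-! ### The antipode of a finite-dimensional Hopf algebra -/

section Antipode

open Coalgebra HopfAlgebra WithConv

variable (k : Type*) [Field k] (H : Type*) [Ring H] [HopfAlgebra k H]

/-- The map `h ↦ h ⊗ 1`. -/
abbrev inl : H →ₐ[k] H ⊗[k] H := Algebra.TensorProduct.includeLeft

/-- The map `h ↦ 1 ⊗ h`. -/
abbrev inr : H →ₐ[k] H ⊗[k] H := Algebra.TensorProduct.includeRight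

/-- `h ↦ h ⊗ 1` as an element of the convolution algebra. -/
def convInl : WithConv (H →ₗ[k] H ⊗[k] H) := toConv (inl k H).toLinearMap

/-- `h ↦ 1 ⊗ h` as an element of the convolution algebra. -/
def convInr : WithConv (H →ₗ[k] H ⊗[k] H) := toConv (inr k H).toLinearMap

/-- `h ↦ S h ⊗ 1` as an element of the convolution algebra. -/
def convAntipodeInl : WithConv (H →ₗ[k] H ⊗[k] H) :=
  toConv ((inl k H).toLinearMap ∘ₗ antipode k)

/-- `h ↦ 1 ⊗ S h` as an element of the convolution algebra. -/
def convAntipodeInr : WithConv (H →ₗ[k] H ⊗[k] H) :=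
  toConv ((inr k H).toLinearMap ∘ₗ antipode k)

variable {k H}

/-! ### Convolution identities in Hom(H, H ⊗ H) -/

lemma convInl_mul_convInr : convInl k H * convInr k H = toConv comul := by
  ext h
  rw [(ℛ k h).convMul_apply]
  simp [convInl, convInr, (ℛ k h).eq]

lemma algHom_comp_convOne {A : Type*} [Ring A] [Algebra k A] (f : H →ₐ[k] A) :
    toConv (f.toLinearMap ∘ₗ (1 : WithConv (H →ₗ[k] H)).ofConv) = 1 := by
  ext h
  simp

lemma antipodeInl_mul_inl : convAntipodeInl k H * convInl k H = 1 := by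
  rw [← algHom_comp_convOne (inl k H), ← LinearMap.antipode_mul_id,
    LinearMap.algHom_comp_convMul_distrib]
  rfl

lemma inl_mul_antipodeInl : convInl k H * convAntipodeInl k H = 1 := by
  rw [← algHom_comp_convOne (inl k H), ← LinearMap.id_mul_antipode,
    LinearMap.algHom_comp_convMul_distrib]
  rfl

lemma antipodeInr_mul_inr : convAntipodeInr k H * convInr k H = 1 := by
  rw [← algHom_comp_convOne (inr k H), ← LinearMap.antipode_mul_id,
    LinearMap.algHom_comp_convMul_distrib]
  rfl

/-- The antipode is anti-comultiplicative. -/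
lemma comul_comp_antipode :
    toConv (comul ∘ₗ antipode k (A := H)) = convAntipodeInr k H * convAntipodeInl k H := by
  -- Both sides are convolution inverses of Δ, one on the right and one on the left: Δ factors as (h
  -- ⊗ 1) * (1 ⊗ h), and the inverse factors in reverse order cancel from the inside.
  refine (left_inv_eq_right_inv ?_ (LinearMap.comul_right_inv (R := k) (C := H))).symm
  rw [← convInl_mul_convInr, mul_assoc, ← mul_assoc _ (convInl k H), antipodeInl_mul_inl, one_mul,
    antipodeInr_mul_inr]

lemma comul_antipode (h : H) {ι : Type*} (r : Repr k h ι) :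
    comul (R := k) (antipode k h) =
      ∑ i ∈ r.index, antipode k (r.right i) ⊗ₜ[k] antipode k (r.left i) := by
  have := congr(($(comul_comp_antipode (k := k) (H := H))) h)
  rw [r.convMul_apply] at this
  simpa [convAntipodeInl, convAntipodeInr] using this

lemma comul_antipode_mul_inl :
    toConv (comul ∘ₗ antipode k (A := H)) * convInl k H = convAntipodeInr k H := by
  rw [comul_comp_antipode, mul_assoc, antipodeInl_mul_inl, mul_one]

lemma sum_comul_antipode_mul (h : H) {ι : Type*} (r : Repr k h ι) :
    ∑ i ∈ r.index, comul (R := k) (antipode k (r.left i)) * (r.right i ⊗ₜ[k] (1 : H)) =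
      1 ⊗ₜ[k] antipode k h := by
  have := congr(($(comul_antipode_mul_inl (k := k) (H := H))) h)
  rw [r.convMul_apply] at this
  simpa [convInl, convAntipodeInr] using this

lemma antipodeInl_mul_inr_apply (h : H) :
    (convAntipodeInl k H * convInr k H) h = (antipode k).rTensor H (comul h) := by
  rw [(ℛ k h).convMul_apply, ← (ℛ k h).eq]
  simp [convAntipodeInl, convInr]

/-- `∑ h₁ S(h₂) ⊗ h₃ = 1 ⊗ h`. -/
lemma sum_mul_antipode_rTensor (h : H) {ι : Type*} (r : Repr k h ι) :
    ∑ i ∈ r.index, (r.left i ⊗ₜ[k] (1 : H)) * (antipode k).rTensor H (comul (r.right i)) =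
      1 ⊗ₜ[k] h := by
  have : convInl k H * (convAntipodeInl k H * convInr k H) = convInr k H := by
    rw [← mul_assoc, inl_mul_antipodeInl, one_mul]
  have := congr(($this) h)
  rw [r.convMul_apply] at this
  simp only [antipodeInl_mul_inr_apply] at this
  simpa [convInl, convInr] using this

/-- `∑ S(h₁) h₂ ⊗ h₃ = 1 ⊗ h`. -/
lemma sum_antipode_mul_comul (h : H) {ι : Type*} (r : Repr k h ι) :
    ∑ i ∈ r.index, (antipode k (r.left i) ⊗ₜ[k] (1 : H)) * comul (r.right i) =
      1 ⊗ₜ[k] h := by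
  have : convAntipodeInl k H * (convInl k H * convInr k H) = convInr k H := by
    rw [← mul_assoc, antipodeInl_mul_inl, one_mul]
  have := congr(($this) h)
  rw [r.convMul_apply, convInl_mul_convInr] at this
  simpa [convAntipodeInl, convInr] using this

/-! ### Hit actions of functionals -/

variable (k H) in
/-- Contraction of the left tensor factor with a functional. -/
def contractLeft (g : H →ₗ[k] k) : H ⊗[k] H →ₗ[k] H := TensorProduct.lid k H ∘ₗ g.rTensor H

variable (k H) in
/-- Contraction of the right tensor factor with a functional. -/
def contractRight (g : H →ₗ[k] k) : H ⊗[k] H →ₗ[k] H := TensorProduct.rid k H ∘ₗ g.lTensor H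

@[simp] lemma contractLeft_tmul (g : H →ₗ[k] k) (x y : H) :
    contractLeft k H g (x ⊗ₜ y) = g x • y := by simp [contractLeft]

@[simp] lemma contractRight_tmul (g : H →ₗ[k] k) (x y : H) :
    contractRight k H g (x ⊗ₜ y) = g y • x := by simp [contractRight]

/-- The right hit action `z ↦ g(z₁) z₂` of a functional. -/
def hitLeft (g : H →ₗ[k] k) : Module.End k H := contractLeft k H g ∘ₗ comul

/-- The left hit action `z ↦ z₁ g(z₂)` of a functional. -/
def hitRight (g : H →ₗ[k] k) : Module.End k H := contractRight k H g ∘ₗ comul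

lemma hitLeft_apply (g : H →ₗ[k] k) (h : H) {ι : Type*} (r : Repr k h ι) :
    hitLeft g h = ∑ i ∈ r.index, g (r.left i) • r.right i := by
  simp [hitLeft, ← r.eq]

lemma hitRight_apply (g : H →ₗ[k] k) (h : H) {ι : Type*} (r : Repr k h ι) :
    hitRight g h = ∑ i ∈ r.index, g (r.right i) • r.left i := by
  simp [hitRight, ← r.eq]

/-- By coassociativity both sides are ∑ g(h₁) h₂ g'(h₃). -/
lemma hitLeft_hitRight (g g' : H →ₗ[k] k) (h : H) :
    hitLeft g (hitRight g' h) = hitRight g' (hitLeft g h) := by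
  let T : H ⊗[k] (H ⊗[k] H) →ₗ[k] H :=
    TensorProduct.lid k H ∘ₗ TensorProduct.map g (contractRight k H g')
  have h₁ (t : H ⊗[k] H) : hitLeft g (contractRight k H g' t) =
      T (TensorProduct.assoc k H H H (comul.rTensor H t)) := by
    induction t with
    | zero => simp
    | add a b ha hb => simp only [map_add, ha, hb]
    | tmul x y =>
      rw [contractRight_tmul, map_smul, hitLeft_apply g x (ℛ k x), LinearMap.rTensor_tmul,
        ← (ℛ k x).eq]
      simp [T, TensorProduct.sum_tmul, Finset.smul_sum, smul_smul, mul_comm]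
  have h₂ (t : H ⊗[k] H) : hitRight g' (contractLeft k H g t) = T (comul.lTensor H t) := by
    induction t with
    | zero => simp
    | add a b ha hb => simp only [map_add, ha, hb]
    | tmul x y =>
      rw [contractLeft_tmul, map_smul]
      simp [T, hitRight]
  exact (h₁ _).trans ((congrArg T (coassoc_apply h)).trans (h₂ _).symm)

/-! ### Integrals as traces -/

/-- The functional `x ↦ Tr (z ↦ x S²(z₁) g(z₂))`. -/
def traceIntegral (g : H →ₗ[k] k) : H →ₗ[k] k :=
  LinearMap.trace k H ∘ₗ
    LinearMap.lcomp k H ((antipode k ∘ₗ antipode k) ∘ₗ hitRight g) ∘ₗ LinearMap.mul k H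

lemma traceIntegral_apply (g : H →ₗ[k] k) (x : H) : traceIntegral g x =
    LinearMap.trace k H (LinearMap.mulLeft k x ∘ₗ (antipode k ∘ₗ antipode k) ∘ₗ hitRight g) :=
  rfl

variable [FiniteDimensional k H]

lemma sum_apply_smul_coord {M : Type*} [AddCommGroup M] [Module k M] (f : H →ₗ[k] M) (x : H) :
    ∑ i, (Module.finBasis k H).coord i x • f (Module.finBasis k H i) = f x := by
  conv_rhs => rw [← (Module.finBasis k H).sum_repr x]
  rw [map_sum]
  simp only [map_smul, Module.Basis.coord_apply]

/-- Summing over the dual bases turns the right side into ∑ g(x₁ S²(z₂)₁ S(z₁)) x₂ S²(z₂)₂, which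
collapses by `sum_comul_antipode_mul` at S(z). The form is chosen so that the outer hit action can
be rotated under a trace. -/
lemma hitLeft_mul_antipode_antipode (g : H →ₗ[k] k) (x z : H) :
    hitLeft g x * antipode k (antipode k z) =
      ∑ i, hitLeft ((Module.finBasis k H).coord i) (x * antipode k (antipode k
        (hitLeft (g ∘ₗ LinearMap.mulLeft k (Module.finBasis k H i) ∘ₗ antipode k) z))) := by
  let b := Module.finBasis k H
  have h₁ (v w : H) : ∑ i, g (b i * v) • hitLeft (b.coord i) w =
      contractLeft k H g (comul w * (v ⊗ₜ 1)) := by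
    simp only [hitLeft_apply _ w (ℛ k w), ← (ℛ k w).eq, Finset.smul_sum, Finset.sum_mul, map_sum]
    rw [Finset.sum_comm]
    refine Finset.sum_congr rfl fun j _ => ?_
    simp only [smul_smul, ← Finset.sum_smul, Algebra.TensorProduct.tmul_mul_tmul,
      contractLeft_tmul, mul_one]
    congr 1
    refine Eq.trans ?_ (sum_apply_smul_coord (g ∘ₗ LinearMap.mulRight k v) _)
    simp [b, mul_comm]
  have h₂ (i) : hitLeft (b.coord i) (x * antipode k (antipode k
        (hitLeft (g ∘ₗ LinearMap.mulLeft k (b i) ∘ₗ antipode k) z))) =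
      ∑ j ∈ (ℛ k z).index, g (b i * antipode k ((ℛ k z).left j)) •
        hitLeft (b.coord i) (x * antipode k (antipode k ((ℛ k z).right j))) := by
    rw [hitLeft_apply _ z (ℛ k z)]
    simp [Finset.mul_sum]
  -- S is anti-comultiplicative, so the legs are exchanged.
  let r : Repr k (antipode k z) (H × H) :=
    ⟨(ℛ k z).index, fun i => antipode k ((ℛ k z).right i), fun i => antipode k ((ℛ k z).left i),
      (comul_antipode z (ℛ k z)).symm⟩
  have h₃ := sum_comul_antipode_mul _ r
  rw [Finset.sum_congr rfl fun i _ => h₂ i, Finset.sum_comm,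
    Finset.sum_congr rfl fun j _ => h₁ _ _]
  simp only [Bialgebra.comul_mul, mul_assoc, ← map_sum, ← Finset.mul_sum]
  refine Eq.trans ?_ congr(contractLeft k H g (comul x * $h₃.symm))
  simp only [hitLeft, LinearMap.comp_apply]
  generalize (comul x : H ⊗[k] H) = t
  induction t with
  | zero => simp
  | add a b ha hb => simp only [map_add, add_mul, ha, hb]
  | tmul a c => simp

/-- The dual basis sum leaves ∑ g(z₁ S(z₂)) z₃ = g(1) z. -/
lemma sum_hitLeft_hitLeft (g : H →ₗ[k] k) (z : H) :
    ∑ i, hitLeft (g ∘ₗ LinearMap.mulLeft k (Module.finBasis k H i) ∘ₗ antipode k)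
      (hitLeft ((Module.finBasis k H).coord i) z) = g 1 • z := by
  let b := Module.finBasis k H
  have h₁ (y w : H) : ∑ i, b.coord i y •
      hitLeft (g ∘ₗ LinearMap.mulLeft k (b i) ∘ₗ antipode k) w =
      contractLeft k H g ((y ⊗ₜ 1) * (antipode k).rTensor H (comul w)) := by
    simp only [hitLeft_apply _ w (ℛ k w), ← (ℛ k w).eq, Finset.smul_sum, Finset.mul_sum, map_sum]
    rw [Finset.sum_comm]
    refine Finset.sum_congr rfl fun j _ => ?_
    simp only [smul_smul, ← Finset.sum_smul, Algebra.TensorProduct.tmul_mul_tmul,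
      contractLeft_tmul, one_mul, LinearMap.rTensor_tmul]
    congr 1
    refine Eq.trans ?_
      (sum_apply_smul_coord (g ∘ₗ LinearMap.mulRight k (antipode k ((ℛ k w).left j))) _)
    simp [b]
  simp only [hitLeft_apply _ z (ℛ k z), map_sum, map_smul]
  rw [Finset.sum_comm, Finset.sum_congr rfl fun j _ => h₁ _ _, ← map_sum,
    sum_mul_antipode_rTensor, contractLeft_tmul]

/-- The operator under the trace splits as ∑ qᵢ A pᵢ with hit actions pᵢ, qᵢ. Cyclicity moves qᵢ to
the far end, where ∑ pᵢ qᵢ is the scalar g(1). Thus the trace functional is an integral. -/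
lemma traceIntegral_hitLeft (f g : H →ₗ[k] k) (x : H) :
    traceIntegral f (hitLeft g x) = g 1 * traceIntegral f x := by
  let b := Module.finBasis k H
  let A : Module.End k H := LinearMap.mulLeft k x ∘ₗ (antipode k ∘ₗ antipode k) ∘ₗ hitRight f
  let p (i) := hitLeft (g ∘ₗ LinearMap.mulLeft k (b i) ∘ₗ antipode k)
  have h₁ : LinearMap.mulLeft k (hitLeft g x) ∘ₗ (antipode k ∘ₗ antipode k) ∘ₗ hitRight f =
      ∑ i, hitLeft (b.coord i) * (A * p i) := by
    ext z
    simp only [LinearMap.comp_apply, LinearMap.mulLeft_apply, hitLeft_mul_antipode_antipode,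
      LinearMap.sum_apply, Module.End.mul_apply, A, p, hitLeft_hitRight, b]
  have h₂ : ∑ i, p i * hitLeft (b.coord i) = g 1 • LinearMap.id := by
    ext z
    simpa using sum_hitLeft_hitLeft g z
  rw [traceIntegral_apply, traceIntegral_apply, h₁, map_sum]
  simp only [LinearMap.trace_mul_comm k (hitLeft _), mul_assoc]
  rw [← map_sum, ← Finset.mul_sum, h₂]
  change LinearMap.trace k H (A * (g 1 • 1)) = g 1 * LinearMap.trace k H A
  simp

/-- Over dual bases, ∑ S(bᵢ) S²(z₁) bᵢ*(z₂) = S(S(z₁) z₂) = ε(z) 1. This operator has trace ε(1) =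
1, so the traces composing it cannot all vanish. -/
lemma exists_traceIntegral_ne_zero : ∃ f : H →ₗ[k] k, traceIntegral f ≠ 0 := by
  by_contra! hf
  let b := Module.finBasis k H
  have h : ∑ i, LinearMap.mulLeft k (antipode k (b i)) ∘ₗ (antipode k ∘ₗ antipode k) ∘ₗ
      hitRight (b.coord i) = (counit (R := k) (A := H)).smulRight (1 : H) := by
    ext z
    simp only [LinearMap.sum_apply, LinearMap.comp_apply, hitRight_apply _ z (ℛ k z), map_sum,
      map_smul, LinearMap.mulLeft_apply]
    rw [Finset.sum_comm]
    have (j : H × H) : ∑ i, b.coord i ((ℛ k z).right j) •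
        (antipode k (b i) * antipode k (antipode k ((ℛ k z).left j))) =
        antipode k (antipode k ((ℛ k z).left j) * (ℛ k z).right j) := by
      rw [antipode_mul_antidistrib]
      exact sum_apply_smul_coord
        (LinearMap.mulRight k (antipode k (antipode k ((ℛ k z).left j))) ∘ₗ antipode k) _
    rw [Finset.sum_congr rfl fun j _ => this j, ← map_sum, sum_antipode_mul_eq_smul]
    simp
  have h' := congr(LinearMap.trace k H $h)
  rw [map_sum, Finset.sum_eq_zero fun i _ => by
    rw [← traceIntegral_apply, hf, LinearMap.zero_apply], LinearMap.trace_smulRight] at h'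
  simp at h'

/-- The antipode of a finite-dimensional Hopf algebra is injective. -/
lemma antipode_injective : Function.Injective (antipode k (A := H)) := by
  rw [injective_iff_map_eq_zero]
  intro h hh
  obtain ⟨f, hf⟩ := exists_traceIntegral_ne_zero (k := k) (H := H)
  let l := traceIntegral f
  let b := Module.finBasis k H
  -- Testing against all functionals g turns the trace identity into ∑ x₁ l(x₂) = l(x) 1.
  have hl (x : H) : contractRight k H l (comul x) = l x • 1 := by
    rw [← sub_eq_zero, ← Module.forall_dual_apply_eq_zero_iff k]
    intro g
    have := traceIntegral_hitLeft f g x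
    rw [hitLeft_apply g x (ℛ k x)] at this
    rw [← (ℛ k x).eq, map_sub, sub_eq_zero]
    simpa [mul_comm, l] using this
  -- Invariance of l makes the sum a contraction of Δ(x) ∑ Δ(S h₁)(h₂ ⊗ 1) = Δ(x)(1 ⊗ S h), and S h
  -- = 0.
  have h₁ (x : H) : ∑ i ∈ (ℛ k h).index, l (x * antipode k ((ℛ k h).left i)) •
      (ℛ k h).right i = 0 := by
    have hc (t : H ⊗[k] H) (y : H) : contractRight k H l (t * (y ⊗ₜ 1)) =
        contractRight k H l t * y := by
      induction t with
      | zero => simp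
      | add a b ha hb => simp only [map_add, add_mul, ha, hb]
      | tmul a c => simp
    have h₂ (y z : H) : l (x * y) • z =
        contractRight k H l (comul x * (comul y * (z ⊗ₜ 1))) := by
      rw [← mul_assoc, hc, ← Bialgebra.comul_mul, hl]
      simp
    simp only [h₂, ← map_sum, ← Finset.mul_sum]
    rw [sum_comul_antipode_mul, hh]
    simp
  -- Apply l(x S(·)) to the first leg of 1 ⊗ h = ∑ h₁ S(h₂) ⊗ h₃. This gives l(x S²(h₂) S(h₁)) h₃;
  -- expanding h₂ in the basis reduces to the previous identity with x S²(bᵢ) for x.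
  have h₂ (x : H) : l x • h = 0 := by
    let T : H ⊗[k] H →ₗ[k] H := contractLeft k H (l ∘ₗ LinearMap.mulLeft k x ∘ₗ antipode k)
    have key := congr(T $(sum_mul_antipode_rTensor h (ℛ k h)))
    have hT (y w : H) : T ((y ⊗ₜ 1) * (antipode k).rTensor H (comul w)) =
        ∑ i, hitLeft (b.coord i) (l (x * antipode k (antipode k (b i)) * antipode k y) • w) := by
      simp only [map_smul, hitLeft_apply _ w (ℛ k w), ← (ℛ k w).eq, Finset.smul_sum,
        Finset.mul_sum, map_sum]
      rw [Finset.sum_comm]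
      refine Finset.sum_congr rfl fun j _ => ?_
      simp only [smul_smul, ← Finset.sum_smul, Algebra.TensorProduct.tmul_mul_tmul,
        T, contractLeft_tmul, one_mul, LinearMap.rTensor_tmul]
      congr 1
      rw [LinearMap.comp_apply, LinearMap.comp_apply, antipode_mul_antidistrib]
      refine (sum_apply_smul_coord (l ∘ₗ LinearMap.mulLeft k x ∘ₗ
        LinearMap.mulRight k (antipode k y) ∘ₗ antipode k ∘ₗ antipode k)
          ((ℛ k w).left j)).symm.trans ?_
      simp [b, mul_comm, mul_assoc]
    rw [map_sum, Finset.sum_congr rfl fun j _ => hT _ _, Finset.sum_comm] at key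
    simp only [← map_sum, h₁, map_zero, Finset.sum_const_zero] at key
    simpa [T] using key.symm
  obtain ⟨x, hx⟩ := DFunLike.ne_iff.1 hf
  exact (smul_eq_zero.1 (h₂ x)).resolve_left hx

/-! ### The inverse of the antipode -/

variable (k H) in
/-- The antipode of a finite-dimensional Hopf algebra as a linear equivalence. -/
def antipodeEquiv : H ≃ₗ[k] H :=
  LinearEquiv.ofInjectiveEndo (antipode k) antipode_injective

@[simp] lemma antipode_antipodeEquiv_symm (h : H) :
    antipode k ((antipodeEquiv k H).symm h) = h :=
  (antipodeEquiv k H).apply_symm_apply h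

@[simp] lemma antipodeEquiv_symm_antipode (h : H) :
    (antipodeEquiv k H).symm (antipode k h) = h :=
  (antipodeEquiv k H).symm_apply_apply h

lemma antipodeEquiv_symm_mul (x y : H) : (antipodeEquiv k H).symm (x * y) =
    (antipodeEquiv k H).symm y * (antipodeEquiv k H).symm x := by
  apply antipode_injective (k := k)
  simp [antipode_mul_antidistrib]

lemma antipodeEquiv_symm_one : (antipodeEquiv k H).symm 1 = 1 := by
  apply antipode_injective (k := k)
  simp

/-- `∑ S⁻¹(h₂) h₁ = ε(h)`. -/
lemma sum_antipodeEquiv_symm_mul (h : H) {ι : Type*} (r : Repr k h ι) :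
    ∑ i ∈ r.index, (antipodeEquiv k H).symm (r.right i) * r.left i = counit (R := k) h • 1 := by
  apply antipode_injective (k := k)
  simp [antipode_mul_antidistrib, sum_antipode_mul_eq_smul]

/-- `∑ h₂ S⁻¹(h₁) = ε(h)`. -/
lemma sum_mul_antipodeEquiv_symm (h : H) {ι : Type*} (r : Repr k h ι) :
    ∑ i ∈ r.index, r.right i * (antipodeEquiv k H).symm (r.left i) = counit (R := k) h • 1 := by
  apply antipode_injective (k := k)
  simp [antipode_mul_antidistrib, sum_mul_antipode_eq_smul]

end Antipode

/-! ### Diagonal actions -/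

section Diagonal

variable {k : Type*} [Field k] {H : Type*} [Ring H] [Bialgebra k H] {U W X : Type*}
  [AddCommGroup U] [Module k U] [AddCommGroup W] [Module k W] [AddCommGroup X] [Module k X]

/-- The diagonal action `h ↦ (u ⊗ w ↦ ∑ u h₁ ⊗ w h₂)`. -/
def diag (a : H →ₗ[k] Module.End k U) (b : H →ₗ[k] Module.End k W) :
    H →ₗ[k] Module.End k (U ⊗[k] W) :=
  TensorProduct.homTensorHomMap (.id k) U W U W ∘ₗ TensorProduct.map a b ∘ₗ Coalgebra.comul

lemma diag_tmul (a : H →ₗ[k] Module.End k U) (b : H →ₗ[k] Module.End k W) (h : H) (u : U)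
    (w : W) : diag a b h (u ⊗ₜ w) =
      TensorProduct.map (a.flip u) (b.flip w) (Coalgebra.comul (R := k) h) := by
  simp only [diag, LinearMap.comp_apply]
  generalize (Coalgebra.comul (R := k) h) = t
  induction t with
  | zero => simp
  | add x y hx hy => simp only [map_add, LinearMap.add_apply, hx, hy]
  | tmul x y => simp

lemma flip_diag (a : H →ₗ[k] Module.End k U) (b : H →ₗ[k] Module.End k W) (u : U) (w : W) :
    (diag a b).flip (u ⊗ₜ w) = TensorProduct.map (a.flip u) (b.flip w) ∘ₗ Coalgebra.comul :=
  LinearMap.ext fun h => diag_tmul a b h u w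

variable (k H) in
/-- The action through the counit. -/
def counitAction : H →ₗ[k] Module.End k k := Coalgebra.counit.smulRight LinearMap.id

lemma lTensor_diag (a : H →ₗ[k] Module.End k U) (b : H →ₗ[k] Module.End k W)
    (c : H →ₗ[k] Module.End k X) (f : W →ₗ[k] X) (hf : ∀ h w, f (b h w) = c h (f w)) (h : H)
    (t : U ⊗[k] W) : f.lTensor U (diag a b h t) = diag a c h (f.lTensor U t) := by
  induction t with
  | zero => simp
  | add x y hx hy => simp only [map_add, hx, hy]
  | tmul u w =>
    have : c.flip (f w) = f ∘ₗ b.flip w := LinearMap.ext fun h => (hf h w).symm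
    rw [LinearMap.lTensor_tmul, diag_tmul, diag_tmul, this, ← LinearMap.comp_apply,
      LinearMap.lTensor_comp_map]

lemma rTensor_diag (a : H →ₗ[k] Module.End k U) (b : H →ₗ[k] Module.End k W)
    (c : H →ₗ[k] Module.End k X) (f : U →ₗ[k] X) (hf : ∀ h u, f (a h u) = c h (f u)) (h : H)
    (t : U ⊗[k] W) : f.rTensor W (diag a b h t) = diag c b h (f.rTensor W t) := by
  induction t with
  | zero => simp
  | add x y hx hy => simp only [map_add, hx, hy]
  | tmul u w =>
    have : c.flip (f u) = f ∘ₗ a.flip u := LinearMap.ext fun h => (hf h u).symm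
    rw [LinearMap.rTensor_tmul, diag_tmul, diag_tmul, this, ← LinearMap.comp_apply,
      LinearMap.rTensor_comp_map]

lemma assoc_diag (a : H →ₗ[k] Module.End k U) (b : H →ₗ[k] Module.End k W)
    (c : H →ₗ[k] Module.End k X) (h : H) (t : (U ⊗[k] W) ⊗[k] X) :
    TensorProduct.assoc k U W X (diag (diag a b) c h t) =
      diag a (diag b c) h (TensorProduct.assoc k U W X t) := by
  suffices (TensorProduct.assoc k U W X).toLinearMap ∘ₗ diag (diag a b) c h =
      diag a (diag b c) h ∘ₗ (TensorProduct.assoc k U W X).toLinearMap from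
    LinearMap.congr_fun this t
  refine TensorProduct.ext_threefold fun u w x => ?_
  simp only [LinearMap.comp_apply, LinearEquiv.coe_coe, TensorProduct.assoc_tmul, diag_tmul,
    flip_diag]
  rw [← LinearMap.map_comp_rTensor, ← LinearMap.map_comp_lTensor, LinearMap.comp_apply,
    LinearMap.comp_apply, ← Coalgebra.coassoc_apply, TensorProduct.map_map_assoc]

lemma assoc_symm_diag (a : H →ₗ[k] Module.End k U) (b : H →ₗ[k] Module.End k W)
    (c : H →ₗ[k] Module.End k X) (h : H) (t : U ⊗[k] (W ⊗[k] X)) :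
    (TensorProduct.assoc k U W X).symm (diag a (diag b c) h t) =
      diag (diag a b) c h ((TensorProduct.assoc k U W X).symm t) := by
  rw [LinearEquiv.symm_apply_eq, assoc_diag, LinearEquiv.apply_symm_apply]

lemma rid_diag (a : H →ₗ[k] Module.End k U) (h : H) (t : U ⊗[k] k) :
    TensorProduct.rid k U (diag a (counitAction k H) h t) = a h (TensorProduct.rid k U t) := by
  induction t with
  | zero => simp
  | add x y hx hy => simp only [map_add, hx, hy]
  | tmul u c =>
    have (s : H ⊗[k] H) : TensorProduct.rid k U
        (TensorProduct.map (a.flip u) ((counitAction k H).flip c) s) =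
        c • a.flip u (TensorProduct.rid k H (Coalgebra.counit.lTensor H s)) := by
      induction s with
      | zero => simp
      | add x y hx hy => simp only [map_add, hx, hy, smul_add]
      | tmul x y => simp [counitAction, smul_smul, mul_comm]
    rw [diag_tmul, this, Coalgebra.lTensor_counit_comul]
    simp

lemma lid_diag (a : H →ₗ[k] Module.End k U) (h : H) (t : k ⊗[k] U) :
    TensorProduct.lid k U (diag (counitAction k H) a h t) = a h (TensorProduct.lid k U t) := by
  induction t with
  | zero => simp
  | add x y hx hy => simp only [map_add, hx, hy]
  | tmul c u =>
    have (s : H ⊗[k] H) : TensorProduct.lid k U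
        (TensorProduct.map ((counitAction k H).flip c) (a.flip u) s) =
        c • a.flip u (TensorProduct.lid k H (Coalgebra.counit.rTensor H s)) := by
      induction s with
      | zero => simp
      | add x y hx hy => simp only [map_add, hx, hy, smul_add]
      | tmul x y => simp [counitAction, smul_smul, mul_comm]
    rw [diag_tmul, this, Coalgebra.rTensor_counit_comul]
    simp

lemma diag_comp {L : Type*} [Ring L] [Bialgebra k L] (g : L →ₐc[k] H)
    (a : H →ₗ[k] Module.End k U) (b : H →ₗ[k] Module.End k W) (l : L) :
    diag a b (g l) = diag (a ∘ₗ (g : L →ₗ[k] H)) (b ∘ₗ (g : L →ₗ[k] H)) l := by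
  simp only [diag, LinearMap.comp_apply, TensorProduct.map_comp]
  rw [← CoalgHomClass.map_comp_comul_apply]

end Diagonal

/-! ### Right modules and their depth -/

namespace RightModule

variable {k : Type u} [Field k]

section Algebra

variable {H : Type u} [Ring H] [Algebra k H]

lemma op_smul (W : RightModule k H) (h : Hᵐᵒᵖ) (w : W.carrier) : h • w = W.act h w := rfl

/-- The action of `H` on a right module as a linear map. -/
def rho (W : RightModule k H) : H →ₗ[k] Module.End k W.carrier :=
  W.act.toLinearMap ∘ₗ (opLinearEquiv k).toLinearMap

lemma rho_apply (W : RightModule k H) (h : H) : W.rho h = W.act (op h) := rfl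

lemma rho_mul_apply (W : RightModule k H) (a b : H) (w : W.carrier) :
    W.rho (a * b) w = W.rho b (W.rho a w) := by
  simp [rho_apply]

lemma rho_one_apply (W : RightModule k H) (w : W.carrier) : W.rho 1 w = w := by
  simp [rho_apply]

/-- A linear map commuting with the right actions, as a module homomorphism. -/
def homMk {U W : RightModule k H} (f : U.carrier →ₗ[k] W.carrier)
    (hf : ∀ h u, f (U.act (op h) u) = W.act (op h) (f u)) : U.carrier →ₗ[Hᵐᵒᵖ] W.carrier where
  toFun := f
  map_add' := map_add f
  map_smul' h u := hf h.unop u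

end Algebra

section Bialgebra

variable {H : Type u} [Ring H] [Bialgebra k H]

lemma rho_tensor (U W : RightModule k H) : (U.tensor W).rho = diag U.rho W.rho := by
  have key (t : H ⊗[k] H) : Module.endTensorEndAlgHom (R := k) (S := k) (A := k)
      (Algebra.TensorProduct.map U.act W.act
        ((Algebra.TensorProduct.opAlgEquiv k k H H).symm (op t))) =
      TensorProduct.homTensorHomMap (.id k) _ _ _ _ (TensorProduct.map U.rho W.rho t) := by
    induction t with
    | zero => simp
    | add a b ha hb => simp only [op_add, map_add, ha, hb]
    | tmul a b =>
      refine TensorProduct.ext' fun u w => ?_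
      simp [Module.endTensorEndAlgHom_apply, rho_apply]
  exact LinearMap.ext fun h => key _

lemma tensor_act (U W : RightModule k H) (h : H) (t : U.carrier ⊗[k] W.carrier) :
    (U.tensor W).act (op h) t = diag U.rho W.rho h t :=
  LinearMap.congr_fun (LinearMap.congr_fun (rho_tensor U W) h) t

lemma rho_unit : (unit k H).rho = counitAction k H :=
  LinearMap.ext fun _ => LinearMap.ext fun _ => rfl

lemma unit_act (h : H) (c : k) : (unit k H).act (op h) c = Coalgebra.counit (R := k) h * c :=
  LinearMap.congr_fun (LinearMap.congr_fun rho_unit h) c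

lemma tensor_tensor_act (U W X : RightModule k H) (h : H)
    (t : (U.carrier ⊗[k] W.carrier) ⊗[k] X.carrier) :
    ((U.tensor W).tensor X).act (op h) t = diag (diag U.rho W.rho) X.rho h t :=
  (tensor_act (U.tensor W) X h t).trans (congrArg (fun a => diag a X.rho h t) (rho_tensor U W))

lemma tensor_tensor_act' (U W X : RightModule k H) (h : H)
    (t : U.carrier ⊗[k] (W.carrier ⊗[k] X.carrier)) :
    (U.tensor (W.tensor X)).act (op h) t = diag U.rho (diag W.rho X.rho) h t :=
  (tensor_act U (W.tensor X) h t).trans (congrArg (fun a => diag U.rho a h t) (rho_tensor W X))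

/-- The tensor product of a module with a module homomorphism. -/
def lTensorHom (U : RightModule k H) {W X : RightModule k H} (f : W.carrier →ₗ[Hᵐᵒᵖ] X.carrier) :
    (U.tensor W).carrier →ₗ[Hᵐᵒᵖ] (U.tensor X).carrier :=
  homMk (U := U.tensor W) (W := U.tensor X) ((f.restrictScalars k).lTensor U.carrier) fun h t =>
    (congrArg _ (tensor_act U W h t)).trans <|
      (lTensor_diag U.rho W.rho X.rho (f.restrictScalars k)
        (fun x w => f.map_smul (op x) w) h t).trans (tensor_act U X h _).symm

/-- The associator. -/
def assocHom (U W X : RightModule k H) :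
    ((U.tensor W).tensor X).carrier →ₗ[Hᵐᵒᵖ] (U.tensor (W.tensor X)).carrier :=
  homMk (U := (U.tensor W).tensor X) (W := U.tensor (W.tensor X))
    (TensorProduct.assoc k U.carrier W.carrier X.carrier).toLinearMap fun h t =>
      (congrArg _ (tensor_tensor_act U W X h t)).trans <|
        (assoc_diag U.rho W.rho X.rho h t).trans (tensor_tensor_act' U W X h _).symm

/-- The inverse associator. -/
def assocInvHom (U W X : RightModule k H) :
    (U.tensor (W.tensor X)).carrier →ₗ[Hᵐᵒᵖ] ((U.tensor W).tensor X).carrier :=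
  homMk (U := U.tensor (W.tensor X)) (W := (U.tensor W).tensor X)
    (TensorProduct.assoc k U.carrier W.carrier X.carrier).symm.toLinearMap fun h t =>
      (congrArg _ (tensor_tensor_act' U W X h t)).trans <|
        (assoc_symm_diag U.rho W.rho X.rho h t).trans (tensor_tensor_act U W X h _).symm

/-- The right unitor. -/
def ridHom (U : RightModule k H) : (U.tensor (unit k H)).carrier →ₗ[Hᵐᵒᵖ] U.carrier :=
  homMk (U := U.tensor (unit k H)) (TensorProduct.rid k U.carrier).toLinearMap fun h t =>
    (congrArg _ ((tensor_act U (unit k H) h t).trans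
      (congrArg (fun a => diag U.rho a h t) rho_unit))).trans (rid_diag U.rho h t)

/-- The left unitor. -/
def lidHom (U : RightModule k H) : ((unit k H).tensor U).carrier →ₗ[Hᵐᵒᵖ] U.carrier :=
  homMk (U := (unit k H).tensor U) (TensorProduct.lid k U.carrier).toLinearMap fun h t =>
    (congrArg _ ((tensor_act (unit k H) U h t).trans
      (congrArg (fun a => diag a U.rho h t) rho_unit))).trans (lid_diag U.rho h t)

lemma lidHom_tmul (U : RightModule k H) (c : k) (u : U.carrier) :
    U.lidHom (show ((unit k H).tensor U).carrier from (c ⊗ₜ[k] u : k ⊗[k] U.carrier)) = c • u :=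
  TensorProduct.lid_tmul u c

section Restrict

variable {L : Type u} [Ring L] [Bialgebra k L] (g : L →ₐc[k] H)

lemma restrict_unit : (unit k H).restrict (g : L →ₐ[k] H) = unit k L := by
  unfold unit restrict
  congr 1
  ext l
  simp

/-- Restriction keeps carriers, so an equality of structures is available; the actions agree because
`g` respects Δ. -/
lemma restrict_tensor (U W : RightModule k H) : (U.tensor W).restrict (g : L →ₐ[k] H) =
    (U.restrict (g : L →ₐ[k] H)).tensor (W.restrict (g : L →ₐ[k] H)) := by
  refine congrArg (fun a => RightModule.mk (U.carrier ⊗[k] W.carrier) a) ?_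
  refine AlgHom.ext fun l => ?_
  refine (LinearMap.congr_fun (rho_tensor U W) (g l.unop)).trans ((diag_comp g U.rho W.rho l.unop).trans ?_)
  exact (LinearMap.congr_fun (rho_tensor (U.restrict (g : L →ₐ[k] H))
    (W.restrict (g : L →ₐ[k] H))) l.unop).symm

lemma restrict_tpow (W : RightModule k H) (n : ℕ) :
    (W.tpow n).restrict (g : L →ₐ[k] H) = (W.restrict (g : L →ₐ[k] H)).tpow n := by
  induction n with
  | zero => exact restrict_unit g
  | succ n ih => rw [tpow, tpow, restrict_tensor, ih]

/-- Restriction is the case of coinvariants in which nothing is killed. -/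
lemma dividesMultiple_restrict {U W : RightModule k H}
    (h : DividesMultiple Hᵐᵒᵖ U.carrier W.carrier) (f : L →ₐ[k] H) :
    DividesMultiple Lᵐᵒᵖ (U.restrict f).carrier (W.restrict f).carrier := by
  have key (X : RightModule k H) : IsCoinvariants (AlgHom.op f) ∅
      (show X.carrier →+ (X.restrict f).carrier from AddMonoidHom.id X.carrier) :=
    { surjective := fun w => ⟨w, rfl⟩
      map_smul := fun _ _ => rfl
      map_eq_zero := by simp
      mem_closure := fun n hn => by
        rw [show n = 0 from hn]
        exact zero_mem _ }
  exact (key U).dividesMultiple (key W) h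

end Restrict

/-! ### Module depth through tensor powers -/

/-- The truncated tensor algebra as a direct sum. -/
def truncatedEquiv (W : RightModule k H) (n : ℕ) :
    (W.truncated (n + 1)).carrier ≃ₗ[Hᵐᵒᵖ] ∀ i : Fin (n + 1), (W.tpow (i + 1)).carrier where
  toFun x := x
  invFun x := x
  map_add' _ _ := rfl
  map_smul' _ _ := rfl
  left_inv _ := rfl
  right_inv _ := rfl

/-- A summand of copies of the unit has H acting through ε, so a linear section of `s` is
automatically H-linear. -/
lemma dividesMultiple_unit_of_surjective {U : RightModule k H}
    (h : DividesMultiple Hᵐᵒᵖ U.carrier (unit k H).carrier)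
    (s : U.carrier →ₗ[Hᵐᵒᵖ] (unit k H).carrier) (hs : Function.Surjective s) :
    DividesMultiple Hᵐᵒᵖ (unit k H).carrier U.carrier := by
  obtain ⟨q, f, g, hfg⟩ := h.exists_sum_eq_id
  have triv (x : H) (u : U.carrier) : U.act (op x) u = Coalgebra.counit (R := k) x • u := by
    conv_lhs => rw [← op_smul, ← hfg u, Finset.smul_sum]
    conv_rhs => rw [← hfg u, Finset.smul_sum]
    refine Finset.sum_congr rfl fun i _ => ?_
    rw [← map_smul, ← LinearMap.map_smul_of_tower (g i)]
    exact congrArg (g i) (unit_act (k := k) x (f i u))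
  obtain ⟨u, hu⟩ := hs (1 : k)
  have hlin (x : H) (c : k) : (Coalgebra.counit (R := k) x * c) • u = U.act (op x) (c • u) := by
    rw [map_smul, triv, smul_smul, mul_comm]
  refine .of_retract (homMk (U := unit k H) (LinearMap.toSpanSingleton k U.carrier u)
    fun x c => (congrArg (LinearMap.toSpanSingleton k U.carrier u) (unit_act (k := k) x c)).trans
      (hlin x c)) s fun c => ?_
  refine (LinearMap.map_smul_of_tower s (show k from c) u).trans ?_
  rw [hu]
  exact mul_one (show k from c)

lemma dividesMultiple_tpow_of_le {W : RightModule k H}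
    (hW : ∀ n, DividesMultiple Hᵐᵒᵖ (W.tpow (n + 1)).carrier (W.tpow (n + 2)).carrier)
    {m n : ℕ} (hmn : m ≤ n) :
    DividesMultiple Hᵐᵒᵖ (W.tpow (m + 1)).carrier (W.tpow (n + 1)).carrier := by
  induction n, hmn using Nat.le_induction with
  | base => exact .of_equiv (.refl _ _)
  | succ n _ ih => exact ih.trans (hW n)

/-- If each tensor power of `W` divides the next one and `W` maps onto the unit module, then
depth `n` means that the tensor powers of degrees `n + 1` and `n` are similar. -/
lemma hasModuleDepth_iff_similar {W : RightModule k H}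
    (hW : ∀ n, DividesMultiple Hᵐᵒᵖ (W.tpow (n + 1)).carrier (W.tpow (n + 2)).carrier)
    (s : W.carrier →ₗ[Hᵐᵒᵖ] (unit k H).carrier) (hs : Function.Surjective s) (n : ℕ) :
    W.HasModuleDepth n ↔ Similar Hᵐᵒᵖ (W.tpow (n + 1)).carrier (W.tpow n).carrier := by
  -- Every summand of the truncation divides the one of highest degree.
  have trunc (n : ℕ) :
      Similar Hᵐᵒᵖ (W.truncated (n + 1)).carrier (W.tpow (n + 1)).carrier := by
    refine (Similar.of_equiv (W.truncatedEquiv n)).trans ⟨.pi fun i => ?_, ?_⟩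
    · exact dividesMultiple_tpow_of_le hW (Nat.le_of_lt_succ i.2)
    · exact .of_pi_right (M := fun i : Fin (n + 1) => (W.tpow (i + 1)).carrier) (Fin.last n)
  cases n with
  | zero =>
    constructor
    · intro h
      -- In degree 0 the chain of divisibilities is not available; the surjection onto the unit
      -- replaces it.
      have h' : DividesMultiple Hᵐᵒᵖ (W.tpow 1).carrier (W.tpow 0).carrier := (trunc 0).2.trans h
      refine ⟨h', dividesMultiple_unit_of_surjective h' (s ∘ₗ W.lidHom) (hs.comp fun w => ?_)⟩
      exact ⟨(1 : k) ⊗ₜ[k] w, (W.lidHom_tmul 1 w).trans (one_smul _ _)⟩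
    · exact fun h => (trunc 0).1.trans h.1
  | succ n =>
    constructor
    · exact fun h => ⟨(trunc (n + 1)).2.trans (h.trans (trunc n).1), hW n⟩
    · exact fun h => (trunc (n + 1)).1.trans (h.1.trans (trunc n).2)

end Bialgebra

end RightModule

/-! ### The generalized permutation module -/

namespace HopfSubalgebra

open Coalgebra

variable {k : Type u} [Field k] {H : Type u} [Ring H] [HopfAlgebra k H] (R : HopfSubalgebra k H)

/-- The inclusion of a Hopf subalgebra as a bialgebra homomorphism. -/
def incl : R.toSubalgebra →ₐc[k] H :=
  BialgHom.ofAlgHom R.toSubalgebra.val rfl (AlgHom.ext fun r => R.incl₂_comulHom r)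

lemma exists_comul_eq {r : H} (hr : r ∈ R.toSubalgebra) : ∃ s, comul (R := k) r = R.incl₂ s :=
  ⟨R.comulHom ⟨r, hr⟩, (R.incl₂_comulHom ⟨r, hr⟩).symm⟩

/-- The projection `H → V = H / R⁺H`. -/
def proj : H →ₗ[k] R.permModule.carrier :=
  show H →ₗ[k] H ⧸ R.augIdeal from (R.augIdeal.mkQ).restrictScalars k

lemma proj_surjective : Function.Surjective R.proj := R.augIdeal.mkQ_surjective

lemma proj_eq_zero_iff {h : H} : R.proj h = 0 ↔ h ∈ R.augIdeal :=
  Submodule.Quotient.mk_eq_zero R.augIdeal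

lemma proj_mul (h x : H) : R.proj (h * x) = R.permModule.rho x (R.proj h) := rfl

lemma proj_mul_left {r : H} (hr : r ∈ R.toSubalgebra) (h : H) :
    R.proj (r * h) = counit (R := k) r • R.proj h := by
  rw [← map_smul, ← sub_eq_zero, ← map_sub, proj_eq_zero_iff]
  have : r * h - counit (R := k) r • h =
      op h • (r - algebraMap k H (counit (R := k) r)) := by
    rw [MulOpposite.smul_eq_mul_unop, unop_op, sub_mul, Algebra.smul_def]
  rw [this]
  refine Submodule.smul_mem _ _ (Submodule.subset_span ⟨?_, by simp⟩)
  exact sub_mem hr (Subalgebra.algebraMap_mem _ _)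

lemma proj_left {r : H} (hr : r ∈ R.toSubalgebra) :
    R.proj r = counit (R := k) r • R.proj 1 := by
  simpa using R.proj_mul_left hr 1

/-- An induction principle for the right ideal `R⁺H`. -/
lemma augIdeal_induction {p : H → Prop} (h0 : p 0) (hadd : ∀ a b, p a → p b → p (a + b))
    (hmul : ∀ r ∈ R.toSubalgebra, counit (R := k) r = 0 → ∀ h, p (r * h)) {a : H}
    (ha : a ∈ R.augIdeal) : p a := by
  suffices ∀ h, p (a * h) by simpa using this 1
  induction ha using Submodule.span_induction with
  | mem x hx => exact hmul x hx.1 hx.2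
  | zero => simpa using h0
  | add x y _ _ hx hy => exact fun h => by simpa [add_mul] using hadd _ _ (hx h) (hy h)
  | smul c x _ hx =>
    intro h
    rw [MulOpposite.smul_eq_mul_unop, mul_assoc]
    exact hx _

/-- The homomorphism `V → W` with `1 ↦ w`, for `w` annihilated by `R⁺`. -/
def permLift (W : RightModule k H) (w : W.carrier)
    (hw : ∀ r ∈ R.toSubalgebra, counit (R := k) r = 0 → W.act (op r) w = 0) :
    R.permModule.carrier →ₗ[Hᵐᵒᵖ] W.carrier :=
  let f : H →ₗ[Hᵐᵒᵖ] W.carrier :=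
    { toFun := fun h => W.rho h w
      map_add' := by simp
      map_smul' := fun c h => W.rho_mul_apply h c.unop w }
  let g : H ⧸ R.augIdeal →ₗ[Hᵐᵒᵖ] W.carrier := R.augIdeal.liftQ f
    (Submodule.span_le.2 fun r hr => hw r hr.1 hr.2)
  { toFun := fun v => g v
    map_add' := map_add g
    map_smul' := map_smul g }

/-- The augmentation of `V`, induced by the counit. -/
def augmentation : R.permModule.carrier →ₗ[Hᵐᵒᵖ] (RightModule.unit k H).carrier :=
  R.permLift (RightModule.unit k H) (1 : k) fun r _ h0 =>
    (RightModule.unit_act r (1 : k)).trans (by rw [h0, zero_mul]; rfl)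

lemma augmentation_proj (h : H) : R.augmentation (R.proj h) = counit (R := k) h :=
  (RightModule.unit_act h (1 : k)).trans (mul_one (M := k) _)

lemma augmentation_surjective : Function.Surjective R.augmentation := fun c =>
  ⟨R.proj (algebraMap k H c), (R.augmentation_proj _).trans
    (Bialgebra.counit_algebraMap (R := k) (A := H) c)⟩

lemma map_proj_comul (h : H) : (R.permModule.tensor R.permModule).rho h
    (show (R.permModule.tensor R.permModule).carrier from
      (R.proj 1 ⊗ₜ[k] R.proj 1 : R.permModule.carrier ⊗[k] R.permModule.carrier)) =
      TensorProduct.map R.proj R.proj (comul h) := by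
  refine (RightModule.tensor_act R.permModule R.permModule h _).trans ?_
  have : R.permModule.rho.flip (R.proj 1) = R.proj := by
    ext x
    rw [LinearMap.flip_apply, ← proj_mul, one_mul]
  rw [diag_tmul, this]

/-- The comultiplication of `V`, induced by that of `H`. -/
def permComul :
    R.permModule.carrier →ₗ[Hᵐᵒᵖ] (R.permModule.tensor R.permModule).carrier :=
  R.permLift (R.permModule.tensor R.permModule)
    (R.proj 1 ⊗ₜ[k] R.proj 1 : R.permModule.carrier ⊗[k] R.permModule.carrier) fun r hr h0 => by
      refine (R.map_proj_comul r).trans ?_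
      -- On R ⊗ R the second leg reaches V only through ε, so Δ(r) maps to [r] ⊗ [1], which vanishes
      -- when ε(r) = 0.
      have key (s : R.toSubalgebra ⊗[k] R.toSubalgebra) :
          TensorProduct.map R.proj R.proj (R.incl₂ s) =
            R.proj (TensorProduct.rid k H (counit.lTensor H (R.incl₂ s))) ⊗ₜ[k] R.proj 1 := by
        induction s with
        | zero => simp
        | add a b ha hb => simp only [map_add, ha, hb, TensorProduct.add_tmul]
        | tmul a b =>
          simp only [incl₂_tmul, TensorProduct.map_tmul, LinearMap.lTensor_tmul,
            TensorProduct.rid_tmul, map_smul]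
          rw [R.proj_left b.2, TensorProduct.tmul_smul, TensorProduct.smul_tmul']
      obtain ⟨s, hs⟩ := R.exists_comul_eq hr
      rw [hs, key, ← hs, lTensor_counit_comul, TensorProduct.rid_tmul, one_smul, R.proj_left hr,
        h0, zero_smul, TensorProduct.zero_tmul]
      rfl

/-- The retraction `V ⊗ V → V` of the comultiplication. -/
def permRetract :
    (R.permModule.tensor R.permModule).carrier →ₗ[Hᵐᵒᵖ] R.permModule.carrier :=
  R.permModule.ridHom ∘ₗ R.permModule.lTensorHom R.augmentation

/-- Both maps are H-linear and V is cyclic, so the generator [1] decides. -/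
lemma permRetract_permComul (v : R.permModule.carrier) :
    R.permRetract (R.permComul v) = v := by
  obtain ⟨h, rfl⟩ := R.proj_surjective v
  have h₁ : R.permRetract (show (R.permModule.tensor R.permModule).carrier from
      (R.proj 1 ⊗ₜ[k] R.proj 1 : R.permModule.carrier ⊗[k] R.permModule.carrier)) = R.proj 1 := by
    refine (TensorProduct.rid_tmul (R := k) (R.proj 1) _).trans ?_
    refine (congrArg (fun c : k => c • R.proj 1) (R.augmentation_proj 1)).trans ?_
    simp
  refine (R.permRetract.map_smul (op h) (show (R.permModule.tensor R.permModule).carrier from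
      (R.proj 1 ⊗ₜ[k] R.proj 1 : R.permModule.carrier ⊗[k] R.permModule.carrier))).trans ?_
  rw [h₁]
  exact (R.proj_mul 1 h).symm.trans (by rw [one_mul])

/-- Tensor the split comultiplication of V with V^{⊗n}. The degrees start at 1 because the unit need
not divide V. -/
lemma dividesMultiple_tpow_succ (n : ℕ) : DividesMultiple Hᵐᵒᵖ
    (R.permModule.tpow (n + 1)).carrier (R.permModule.tpow (n + 2)).carrier := by
  let V := R.permModule
  let U := V.tpow n
  refine .of_retract (U.assocInvHom V V ∘ₗ U.lTensorHom R.permComul)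
    (U.lTensorHom R.permRetract ∘ₗ U.assocHom V V) fun t => ?_
  have h₁ (s : U.carrier ⊗[k] (V.carrier ⊗[k] V.carrier)) :
      U.assocHom V V (U.assocInvHom V V s) = s :=
    (TensorProduct.assoc k U.carrier V.carrier V.carrier).apply_symm_apply s
  have h₂ (t : U.carrier ⊗[k] V.carrier) :
      (R.permRetract.restrictScalars k).lTensor U.carrier
        ((R.permComul.restrictScalars k).lTensor U.carrier t) = t := by
    rw [← LinearMap.comp_apply, ← LinearMap.lTensor_comp]
    have : R.permRetract.restrictScalars k ∘ₗ R.permComul.restrictScalars k =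
        LinearMap.id := LinearMap.ext R.permRetract_permComul
    rw [this, LinearMap.lTensor_id, LinearMap.id_apply]
  exact (congrArg _ (h₁ _)).trans (h₂ t)

lemma hasModuleDepth_iff (n : ℕ) : R.permModule.HasModuleDepth n ↔
    Similar Hᵐᵒᵖ (R.permModule.tpow (n + 1)).carrier (R.permModule.tpow n).carrier :=
  RightModule.hasModuleDepth_iff_similar R.dividesMultiple_tpow_succ R.augmentation
    R.augmentation_surjective n

lemma hasModuleDepth_restrict_iff (n : ℕ) :
    (R.permModule.restrict R.toSubalgebra.val).HasModuleDepth n ↔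
      Similar R.toSubalgebraᵐᵒᵖ ((R.permModule.tpow (n + 1)).restrict R.toSubalgebra.val).carrier
        ((R.permModule.tpow n).restrict R.toSubalgebra.val).carrier := by
  have ht (n : ℕ) : (R.permModule.tpow n).restrict R.toSubalgebra.val =
      (R.permModule.restrict R.toSubalgebra.val).tpow n := RightModule.restrict_tpow R.incl _ n
  rw [ht, ht]
  refine RightModule.hasModuleDepth_iff_similar (fun n => ?_)
    (RightModule.homMk (U := R.permModule.restrict R.toSubalgebra.val)
      (W := RightModule.unit k R.toSubalgebra) (R.augmentation.restrictScalars k)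
      fun r v => R.augmentation.map_smul (op (r : H)) v) R.augmentation_surjective n
  rw [← ht, ← ht]
  exact RightModule.dividesMultiple_restrict (R.dividesMultiple_tpow_succ n) _

end HopfSubalgebra

namespace Bimodule

variable {k : Type u} [Field k] {X Y : Type u} [Ring X] [Algebra k X] [Ring Y] [Algebra k Y]

/-! ### Isomorphisms of bimodules -/

lemma tmul_smul (M : Bimodule k X Y) (x : X) (y : Yᵐᵒᵖ) (m : M.carrier) :
    (x ⊗ₜ[k] y) • m = M.left x (M.right y m) := by
  change Algebra.TensorProduct.lift M.left M.right M.comm (x ⊗ₜ[k] y) m = _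
  simp

lemma left_right_comm (M : Bimodule k X Y) (x : X) (y : Yᵐᵒᵖ) (m : M.carrier) :
    M.left x (M.right y m) = M.right y (M.left x m) :=
  LinearMap.congr_fun (M.comm x y) m

/-- A linear map commuting with both actions, as a homomorphism of modules. -/
def homMk {M N : Bimodule k X Y} (f : M.carrier →ₗ[k] N.carrier)
    (hl : ∀ x m, f (M.left x m) = N.left x (f m))
    (hr : ∀ y m, f (M.right (op y) m) = N.right (op y) (f m)) :
    M.carrier →ₗ[X ⊗[k] Yᵐᵒᵖ] N.carrier where
  toFun := f
  map_add' := map_add f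
  map_smul' e m := by
    induction e with
    | zero =>
      have h0 (P : Bimodule k X Y) (p : P.carrier) : (0 : X ⊗[k] Yᵐᵒᵖ) • p = 0 := by
        change Algebra.TensorProduct.lift P.left P.right P.comm 0 p = 0
        rw [map_zero, LinearMap.zero_apply]
      rw [h0, map_zero, RingHom.id_apply, h0]
    | add a b ha hb => simp only [add_smul, map_add, ha, hb, RingHom.id_apply]
    | tmul x y =>
      rw [RingHom.id_apply, tmul_smul, tmul_smul, hl, ← op_unop y, hr]

/-- Isomorphisms of bimodules. -/
structure Iso (M N : Bimodule k X Y) where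
  /-- The underlying linear equivalence. -/
  equiv : M.carrier ≃ₗ[k] N.carrier
  map_left : ∀ x m, equiv (M.left x m) = N.left x (equiv m)
  map_right : ∀ y m, equiv (M.right (op y) m) = N.right (op y) (equiv m)

/-- Composition of isomorphisms of bimodules. -/
def Iso.trans {M N P : Bimodule k X Y} (e : Iso M N) (e' : Iso N P) : Iso M P where
  equiv := e.equiv.trans e'.equiv
  map_left x m := by simp [e.map_left, e'.map_left]
  map_right y m := by simp [e.map_right, e'.map_right]

/-- Restriction of an isomorphism of bimodules. -/
def Iso.restrict {M N : Bimodule k X Y} (e : Iso M N) {X' Y' : Type u} [Ring X'] [Algebra k X']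
    [Ring Y'] [Algebra k Y'] (f : X' →ₐ[k] X) (g : Y' →ₐ[k] Y) :
    Iso (M.restrict f g) (N.restrict f g) where
  equiv := e.equiv
  map_left x m := e.map_left (f x) m
  map_right y m := e.map_right (g y) m

/-- An isomorphism of bimodules as an equivalence of modules. -/
def Iso.toLinearEquiv {M N : Bimodule k X Y} (e : Iso M N) :
    M.carrier ≃ₗ[X ⊗[k] Yᵐᵒᵖ] N.carrier :=
  { homMk e.equiv.toLinearMap e.map_left e.map_right with
    invFun := e.equiv.symm
    left_inv := e.equiv.symm_apply_apply
    right_inv := e.equiv.apply_symm_apply }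

/-- The right module underlying a bimodule. -/
def toRight (M : Bimodule k X Y) : RightModule k Y where
  carrier := M.carrier
  act := M.right

/-! ### Twisting a bimodule by a right module -/

section Twist

variable {H : Type u} [Ring H] [Bialgebra k H]

lemma rTensor_comm {U U' W : Type*} [AddCommGroup U] [Module k U] [AddCommGroup U'] [Module k U']
    [AddCommGroup W] [Module k W] {a : U →ₗ[k] U} {b : U' →ₗ[k] U'} {e : U →ₗ[k] U'}
    (h : ∀ u, e (a u) = b (e u)) (t : U ⊗[k] W) :
    e.rTensor W (a.rTensor W t) = b.rTensor W (e.rTensor W t) := by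
  rw [← LinearMap.comp_apply, ← LinearMap.comp_apply, ← LinearMap.rTensor_comp,
    ← LinearMap.rTensor_comp, show e ∘ₗ a = b ∘ₗ e from LinearMap.ext h]

lemma assoc_rTensor_rTensor {U V W : Type*} [AddCommGroup U] [Module k U] [AddCommGroup V]
    [Module k V] [AddCommGroup W] [Module k W] (a : U →ₗ[k] U) (t : (U ⊗[k] V) ⊗[k] W) :
    TensorProduct.assoc k U V W ((a.rTensor V).rTensor W t) =
      a.rTensor (V ⊗[k] W) (TensorProduct.assoc k U V W t) := by
  rw [LinearMap.rTensor_tensor]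
  simp

/-- The bimodule `M ⊗ W`, with left action on `M` and the diagonal right action. -/
def twist (M : Bimodule k X H) (W : RightModule k H) : Bimodule k X H where
  carrier := M.carrier ⊗[k] W.carrier
  left := (Module.End.rTensorAlgHom k M.carrier W.carrier).comp M.left
  right := (M.toRight.tensor W).act
  comm x h := by
    refine LinearMap.ext fun t => ?_
    have := rTensor_diag M.toRight.rho W.rho M.toRight.rho (M.left x)
      (fun y m => M.left_right_comm x (op y) m) h.unop t
    exact (congrArg ((M.left x).rTensor W.carrier)
      (RightModule.tensor_act M.toRight W h.unop t)).trans
        (this.trans (RightModule.tensor_act M.toRight W h.unop _).symm)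

lemma twist_right (M : Bimodule k X H) (W : RightModule k H) (h : H)
    (t : M.carrier ⊗[k] W.carrier) :
    (M.twist W).right (op h) t = diag M.toRight.rho W.rho h t :=
  RightModule.tensor_act M.toRight W h t

/-- Twisting is functorial in the bimodule. -/
def Iso.twist {M N : Bimodule k X H} (e : Iso M N) (W : RightModule k H) :
    Iso (M.twist W) (N.twist W) where
  equiv := TensorProduct.congr e.equiv (LinearEquiv.refl k W.carrier)
  map_left x t := rTensor_comm (b := N.left x) (e.map_left x) t
  map_right h t :=
    (congrArg (e.equiv.toLinearMap.rTensor W.carrier) (M.twist_right W h t)).trans <|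
      (rTensor_diag M.toRight.rho W.rho N.toRight.rho e.equiv.toLinearMap e.map_right h t).trans
        (N.twist_right W h _).symm

/-- Twisting twice is twisting by the tensor product. -/
def twistTwist (M : Bimodule k X H) (U W : RightModule k H) :
    Iso ((M.twist U).twist W) (M.twist (U.tensor W)) where
  equiv := TensorProduct.assoc k M.carrier U.carrier W.carrier
  map_left x t := assoc_rTensor_rTensor (M.left x) t
  map_right h t :=
    (congrArg _ (RightModule.tensor_tensor_act M.toRight U W h t)).trans <|
      (assoc_diag M.toRight.rho U.rho W.rho h t).trans
        (RightModule.tensor_tensor_act' M.toRight U W h _).symm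

/-- Twisting by the unit module. -/
def twistUnit (M : Bimodule k X H) : Iso M (M.twist (RightModule.unit k H)) where
  equiv := (TensorProduct.rid k M.carrier).symm
  map_left x m := rfl
  map_right h m := by
    refine (LinearEquiv.symm_apply_eq _).2 ?_
    refine Eq.trans ?_ (congrArg _ (M.twist_right (RightModule.unit k H) h (m ⊗ₜ[k] (1 : k)))).symm
    rw [RightModule.rho_unit]
    refine Eq.trans ?_ (rid_diag M.toRight.rho h _).symm
    exact (congrArg (M.toRight.rho h)
      ((TensorProduct.rid_tmul (R := k) m 1).trans (one_smul k m))).symm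

end Twist

end Bimodule

/-! ### The Galois isomorphism `M ⊗_R H ≃ M ⊗ V` -/

section Galois

open Coalgebra HopfAlgebra

variable {k : Type u} [Field k] {H : Type u} [Ring H] [HopfAlgebra k H]

/-! ### The shear of M ⊗ H -/

namespace RightModule

variable (M : RightModule k H)

/-- The map `M ⊗ H → M ⊗ H`, `m ⊗ h ↦ ∑ m a ⊗ b` where `t h = ∑ a ⊗ b`. -/
def slide (t : H →ₗ[k] H ⊗[k] H) : M.carrier ⊗[k] H →ₗ[k] M.carrier ⊗[k] H :=
  TensorProduct.lift (LinearMap.lcomp k (M.carrier ⊗[k] H) t ∘ₗ LinearMap.rTensorHom H ∘ₗ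
    M.rho.flip)

@[simp] lemma slide_tmul (t : H →ₗ[k] H ⊗[k] H) (m : M.carrier) (h : H) :
    M.slide t (m ⊗ₜ h) = (M.rho.flip m).rTensor H (t h) := by
  simp [slide]

lemma rTensor_flip_rho (a : H) (m : M.carrier) (t : H ⊗[k] H) :
    (M.rho.flip (M.rho a m)).rTensor H t = (M.rho.flip m).rTensor H ((a ⊗ₜ 1) * t) := by
  induction t with
  | zero => simp
  | add x y hx hy => simp only [map_add, mul_add, hx, hy]
  | tmul x y => simp [rho_mul_apply]

/-- Two slides multiply the first legs, and `ht` says that the product is trivial. The pairs (id, (S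
⊗ id)Δ) and (S, Δ) give the two halves of `slideEquiv`. -/
lemma slide_slide (f : H →ₗ[k] H) (t : H →ₗ[k] H ⊗[k] H)
    (ht : ∀ h : H, ∑ i ∈ (ℛ k h).index, (f ((ℛ k h).left i) ⊗ₜ[k] (1 : H)) *
      t ((ℛ k h).right i) = 1 ⊗ₜ h) (x : M.carrier ⊗[k] H) :
    M.slide t (M.slide (f.rTensor H ∘ₗ comul) x) = x := by
  induction x with
  | zero => simp
  | add x y hx hy => simp only [map_add, hx, hy]
  | tmul m h =>
    rw [slide_tmul, LinearMap.comp_apply, ← (ℛ k h).eq]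
    simp only [map_sum, LinearMap.rTensor_tmul, slide_tmul, LinearMap.flip_apply,
      rTensor_flip_rho]
    rw [← map_sum, ht, LinearMap.rTensor_tmul, LinearMap.flip_apply, rho_one_apply]

/-- The automorphism `m ⊗ h ↦ ∑ m h₁ ⊗ h₂` of `M ⊗ H`, with inverse
`m ⊗ h ↦ ∑ m S(h₁) ⊗ h₂`. -/
def slideEquiv : (M.carrier ⊗[k] H) ≃ₗ[k] (M.carrier ⊗[k] H) where
  toLinearMap := M.slide comul
  invFun := M.slide ((antipode k).rTensor H ∘ₗ comul)
  left_inv x := by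
    have := M.slide_slide LinearMap.id ((antipode k).rTensor H ∘ₗ comul)
      (fun h => sum_mul_antipode_rTensor h (ℛ k h)) x
    simpa using this
  right_inv x := M.slide_slide (antipode k) comul (fun h => sum_antipode_mul_comul h (ℛ k h)) x

end RightModule

namespace HopfSubalgebra

variable (R : HopfSubalgebra k H) (M : RightModule k H)

/-- The kernel of `M ⊗ H → M ⊗_R H`. -/
def relations : Submodule k (M.carrier ⊗[k] H) :=
  Submodule.span k {t | ∃ (m : M.carrier) (r : R.toSubalgebra) (h : H),
    t = M.rho (r : H) m ⊗ₜ[k] h - m ⊗ₜ[k] ((r : H) * h)}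

/-- The map `M ⊗ H → M ⊗ V`, `m ⊗ h ↦ ∑ m h₁ ⊗ h₂`. -/
def galoisMap : M.carrier ⊗[k] H →ₗ[k] M.carrier ⊗[k] R.permModule.carrier :=
  R.proj.lTensor M.carrier ∘ₗ M.slideEquiv.toLinearMap

lemma galoisMap_tmul (m : M.carrier) (h : H) :
    R.galoisMap M (m ⊗ₜ h) = TensorProduct.map (M.rho.flip m) R.proj (comul h) := by
  change R.proj.lTensor M.carrier (M.slide comul (m ⊗ₜ h)) = _
  rw [RightModule.slide_tmul, ← LinearMap.comp_apply, LinearMap.lTensor_comp_rTensor]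

lemma galoisMap_surjective : Function.Surjective (R.galoisMap M) :=
  (LinearMap.lTensor_surjective _ R.proj_surjective).comp M.slideEquiv.surjective

/-- A left factor from R passes to V as its counit, so only the first leg of `s` survives. -/
lemma map_proj_incl₂_mul (m : M.carrier) (s : R.toSubalgebra ⊗[k] R.toSubalgebra)
    (t : H ⊗[k] H) : TensorProduct.map (M.rho.flip m) R.proj (R.incl₂ s * t) =
      TensorProduct.map (M.rho.flip m) R.proj
        ((TensorProduct.rid k H (counit.lTensor H (R.incl₂ s)) ⊗ₜ 1) * t) := by
  induction s with
  | zero => simp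
  | add a b ha hb => simp only [map_add, add_mul, TensorProduct.add_tmul, ha, hb]
  | tmul a b =>
    induction t with
    | zero => simp
    | add x y hx hy => simp only [map_add, mul_add, hx, hy]
    | tmul x y =>
      simp only [incl₂_tmul, Algebra.TensorProduct.tmul_mul_tmul, TensorProduct.map_tmul,
        R.proj_mul_left b.2, LinearMap.lTensor_tmul, TensorProduct.rid_tmul, one_mul,
        smul_mul_assoc, map_smul, TensorProduct.tmul_smul, TensorProduct.smul_tmul']

/-- The term m ⊗ r h goes to ∑ m r₁ h₁ ⊗ [r₂ h₂], and absorbing r₂ leaves ∑ m r h₁ ⊗ [h₂]. -/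
lemma relations_le_ker : R.relations M ≤ LinearMap.ker (R.galoisMap M) := by
  refine Submodule.span_le.2 ?_
  rintro _ ⟨m, r, h, rfl⟩
  obtain ⟨s, hs⟩ := R.exists_comul_eq r.2
  rw [SetLike.mem_coe, LinearMap.mem_ker, map_sub, galoisMap_tmul, galoisMap_tmul,
    Bialgebra.comul_mul, hs, map_proj_incl₂_mul, ← hs, lTensor_counit_comul,
    TensorProduct.rid_tmul, one_smul, sub_eq_zero]
  generalize (comul h : H ⊗[k] H) = t
  induction t with
  | zero => simp
  | add x y hx hy => simp only [map_add, mul_add, hx, hy]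
  | tmul x y => simp [RightModule.rho_mul_apply]

/-- As the second leg of Δ(r) lies in R, m S(h₁) S(r₁) ⊗ r₂ h₂ may be moved across ⊗_R to m S(h₁)
S(r₁) r₂ ⊗ h₂; for ε(r) = 0 the latter sums to zero. -/
lemma slide_antipode_incl₂_mul (m : M.carrier) (s : R.toSubalgebra ⊗[k] R.toSubalgebra)
    (t : H ⊗[k] H) :
    (M.rho.flip m).rTensor H ((antipode k).rTensor H t *
        (LinearMap.mul' k H ((antipode k).rTensor H (R.incl₂ s)) ⊗ₜ 1)) -
      (M.rho.flip m).rTensor H ((antipode k).rTensor H (R.incl₂ s * t)) ∈ R.relations M := by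
  induction s with
  | zero => simp
  | add a b ha hb =>
    convert add_mem ha hb using 1
    simp only [map_add, add_mul, mul_add, TensorProduct.add_tmul]
    abel
  | tmul a b =>
    induction t with
    | zero => simp
    | add x y hx hy =>
      convert add_mem hx hy using 1
      simp only [map_add, mul_add, add_mul]
      abel
    | tmul x y =>
      refine Submodule.subset_span ⟨M.rho (antipode k x * antipode k (a : H)) m, b, y, ?_⟩
      simp [incl₂_tmul, antipode_mul_antidistrib, ← RightModule.rho_mul_apply, mul_assoc]

lemma slide_antipode_mem_relations {a : H} (ha : a ∈ R.augIdeal) (m : M.carrier) :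
    M.slideEquiv.symm (m ⊗ₜ a) ∈ R.relations M := by
  refine R.augIdeal_induction (p := fun a => M.slideEquiv.symm (m ⊗ₜ a) ∈ R.relations M)
    (by simp) (fun a b ha hb => ?_) (fun r hr h0 h => ?_) ha
  · rw [TensorProduct.tmul_add, map_add]
    exact add_mem ha hb
  · obtain ⟨s, hs⟩ := R.exists_comul_eq hr
    have := R.slide_antipode_incl₂_mul M m s (comul h)
    rw [← hs, mul_antipode_rTensor_comul_apply, h0, map_zero, TensorProduct.zero_tmul, mul_zero,
      map_zero, zero_sub, neg_mem_iff, ← Bialgebra.comul_mul] at this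
    change M.slide _ _ ∈ _
    rwa [RightModule.slide_tmul]

/-- By right exactness the kernel is the preimage of M ⊗ R⁺H under the shear, and the inverse shear
sends M ⊗ R⁺H into the relations. -/
lemma ker_galoisMap : LinearMap.ker (R.galoisMap M) = R.relations M := by
  refine le_antisymm (fun x hx => ?_) (R.relations_le_ker M)
  have hexact : Function.Exact (R.augIdeal.restrictScalars k).subtype R.proj := fun y => by
    rw [proj_eq_zero_iff]
    simp
  obtain ⟨z, hz⟩ := (lTensor_exact M.carrier hexact R.proj_surjective _).1
    (show R.proj.lTensor M.carrier (M.slideEquiv x) = 0 from hx)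
  rw [← M.slideEquiv.symm_apply_apply x, ← hz]
  clear hz
  induction z with
  | zero => simp
  | add a b ha hb => simpa only [map_add] using add_mem ha hb
  | tmul m a => exact R.slide_antipode_mem_relations M a.2 m

/-- The linear isomorphism `M ⊗_R H ≃ M ⊗ V`. -/
def galoisEquiv :
    ((M.carrier ⊗[k] H) ⧸ R.relations M) ≃ₗ[k] M.carrier ⊗[k] R.permModule.carrier :=
  (Submodule.quotEquivOfEq _ _ (R.ker_galoisMap M).symm).trans
    ((R.galoisMap M).quotKerEquivOfSurjective (R.galoisMap_surjective M))

lemma diag_galoisMap (h : H) (x : M.carrier ⊗[k] H) :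
    diag M.rho R.permModule.rho h (R.galoisMap M x) =
      R.galoisMap M ((LinearMap.mulRight k h).lTensor M.carrier x) := by
  induction x with
  | zero => simp
  | add x y hx hy => simp only [map_add, hx, hy]
  | tmul m y =>
    rw [LinearMap.lTensor_tmul, galoisMap_tmul, galoisMap_tmul, LinearMap.mulRight_apply,
      Bialgebra.comul_mul]
    generalize (comul y : H ⊗[k] H) = t
    induction t with
    | zero => simp
    | add a b ha hb => simp only [map_add, add_mul, ha, hb]
    | tmul a b =>
      rw [TensorProduct.map_tmul, diag_tmul]
      generalize (comul h : H ⊗[k] H) = s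
      induction s with
      | zero => simp
      | add c d hc hd => simp only [map_add, mul_add, hc, hd]
      | tmul c d => simp [RightModule.rho_mul_apply, proj_mul]

lemma galoisMap_rTensor (f : M.carrier →ₗ[k] M.carrier)
    (hf : ∀ h m, f (M.rho h m) = M.rho h (f m)) (x : M.carrier ⊗[k] H) :
    R.galoisMap M (f.rTensor H x) = f.rTensor R.permModule.carrier (R.galoisMap M x) := by
  induction x with
  | zero => simp
  | add x y hx hy => simp only [map_add, hx, hy]
  | tmul m h =>
    rw [LinearMap.rTensor_tmul, galoisMap_tmul, galoisMap_tmul,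
      ← LinearMap.comp_apply (f.rTensor _), LinearMap.rTensor_comp_map,
      show f ∘ₗ M.rho.flip m = M.rho.flip (f m) from LinearMap.ext fun h => hf h m]

/-- The isomorphism `M ⊗_R H ≃ M ⊗ V` of bimodules. -/
def galoisIso {X : Type u} [Ring X] [Algebra k X] (M : Bimodule k X H) :
    Bimodule.Iso ((M.restrict (AlgHom.id k X) R.toSubalgebra.val).tensor
      ((Bimodule.regular k H).restrict R.toSubalgebra.val (AlgHom.id k H)))
      (M.twist R.permModule) where
  equiv := R.galoisEquiv M.toRight
  map_left x q := by
    obtain ⟨t, rfl⟩ := (R.relations M.toRight).mkQ_surjective q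
    exact R.galoisMap_rTensor M.toRight (M.left x) (fun h m => M.left_right_comm x (op h) m) t
  map_right h q := by
    obtain ⟨t, rfl⟩ := (R.relations M.toRight).mkQ_surjective q
    exact (R.diag_galoisMap M.toRight h t).symm.trans
      (M.twist_right R.permModule h _).symm

/-- The tensor power `H ⊗_R ⋯ ⊗_R H` with `n + 1` factors is `H ⊗ V ⊗ ⋯ ⊗ V`, with `n` factors
`V`. -/
def tensorPowerIso : (n : ℕ) → Bimodule.Iso (tensorPower R.toSubalgebra n)
    ((Bimodule.regular k H).twist (R.permModule.tpow n))
  | 0 => Bimodule.twistUnit _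
  | n + 1 => ((R.galoisIso _).trans ((tensorPowerIso n).twist R.permModule)).trans
      (Bimodule.twistTwist _ _ _)

end HopfSubalgebra

end Galois

/-! ### Coinvariants of `H ⊗ W` -/

namespace Bimodule

variable {k : Type u} [Field k] {X Y : Type u} [Ring X] [Algebra k X] [Ring Y] [Algebra k Y]
  (N : Bimodule k X Y)

/-- Scalars of k commute with I, so the additive closure is a subspace and the criteria below may
use k-spans. -/
lemma smul_mem_closure {I : Set (X ⊗[k] Yᵐᵒᵖ)} (c : k) {n : N.carrier}
    (hn : n ∈ AddSubgroup.closure {m | ∃ i ∈ I, ∃ n' : N.carrier, m = i • n'}) :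
    c • n ∈ AddSubgroup.closure {m | ∃ i ∈ I, ∃ n' : N.carrier, m = i • n'} := by
  induction hn using AddSubgroup.closure_induction with
  | mem m hm =>
    obtain ⟨i, hi, n', rfl⟩ := hm
    refine AddSubgroup.subset_closure ⟨i, hi, c • n', ?_⟩
    exact (map_smul (Algebra.TensorProduct.lift N.left N.right N.comm i) c n').symm
  | zero => rw [smul_zero]; exact zero_mem _
  | add a b _ _ ha hb => rw [smul_add]; exact add_mem ha hb
  | neg a _ ha => rw [smul_neg]; exact neg_mem ha

/-- A criterion for coinvariants with respect to the left action. -/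
lemma isCoinvariants_left (W : RightModule k Y) (J : Set X) (π : N.carrier →ₗ[k] W.carrier)
    (hsurj : Function.Surjective π) (hr : ∀ y n, π (N.right (op y) n) = W.act (op y) (π n))
    (hl : ∀ x ∈ J, ∀ n, π (N.left x n) = 0)
    (hker : ∀ n, π n = 0 → n ∈ Submodule.span k {m | ∃ x ∈ J, ∃ n', m = N.left x n'}) :
    IsCoinvariants (fun y : Yᵐᵒᵖ => (1 : X) ⊗ₜ[k] y) {e | ∃ x ∈ J, e = x ⊗ₜ[k] (1 : Yᵐᵒᵖ)}
      π.toAddMonoidHom where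
  surjective := hsurj
  map_smul y n := by
    rw [tmul_smul, map_one, Module.End.one_apply]
    exact hr y.unop n
  map_eq_zero := by
    rintro _ ⟨x, hx, rfl⟩ n
    rw [tmul_smul, map_one, Module.End.one_apply]
    exact hl x hx n
  mem_closure n hn := by
    have hmem := hker n hn
    clear hn
    induction hmem using Submodule.span_induction with
    | mem m hm =>
      obtain ⟨x, hx, n', rfl⟩ := hm
      exact AddSubgroup.subset_closure ⟨_, ⟨x, hx, rfl⟩, n', by
        rw [tmul_smul, map_one, Module.End.one_apply]⟩
    | zero => exact zero_mem _
    | add a b _ _ ha hb => exact add_mem ha hb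
    | smul c a _ ha => exact smul_mem_closure N c ha

/-- A criterion for coinvariants with respect to the right action. -/
lemma isCoinvariants_right {L : Type u} [Ring L] [Algebra k L] (W : RightModule k L) (τ : L → X)
    (J : Set Y) (π : N.carrier →ₗ[k] W.carrier)
    (hsurj : Function.Surjective π) (hl : ∀ l n, π (N.left (τ l) n) = W.act (op l) (π n))
    (hr : ∀ y ∈ J, ∀ n, π (N.right (op y) n) = 0)
    (hker : ∀ n, π n = 0 → n ∈ Submodule.span k {m | ∃ y ∈ J, ∃ n', m = N.right (op y) n'}) :
    IsCoinvariants (fun l : Lᵐᵒᵖ => τ l.unop ⊗ₜ[k] (1 : Yᵐᵒᵖ))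
      {e | ∃ y ∈ J, e = (1 : X) ⊗ₜ[k] op y} π.toAddMonoidHom where
  surjective := hsurj
  map_smul l n := by
    rw [tmul_smul, map_one, Module.End.one_apply]
    exact hl l.unop n
  map_eq_zero := by
    rintro _ ⟨y, hy, rfl⟩ n
    rw [tmul_smul, map_one, Module.End.one_apply]
    exact hr y hy n
  mem_closure n hn := by
    have hmem := hker n hn
    clear hn
    induction hmem using Submodule.span_induction with
    | mem m hm =>
      obtain ⟨y, hy, n', rfl⟩ := hm
      exact AddSubgroup.subset_closure ⟨_, ⟨y, hy, rfl⟩, n', by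
        rw [tmul_smul, map_one, Module.End.one_apply]⟩
    | zero => exact zero_mem _
    | add a b _ _ ha hb => exact add_mem ha hb
    | smul c a _ ha => exact smul_mem_closure N c ha

end Bimodule

section FreeBimodule

open Coalgebra HopfAlgebra

variable {k : Type u} [Field k] {H : Type u} [Ring H] [HopfAlgebra k H]

/-- The bimodule `H ⊗ W`. -/
abbrev free (W : RightModule k H) : Bimodule k H H := (Bimodule.regular k H).twist W

lemma free_right (W : RightModule k H) (x : H) (t : H ⊗[k] W.carrier) :
    (free W).right (op x) t = diag (LinearMap.mul k H).flip W.rho x t :=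
  Bimodule.twist_right (Bimodule.regular k H) W x t

/-- The map `H ⊗ W → W`, `h ⊗ w ↦ ε(h) w`. -/
def freeCounit (W : RightModule k H) : H ⊗[k] W.carrier →ₗ[k] W.carrier :=
  TensorProduct.lid k W.carrier ∘ₗ counit.rTensor W.carrier

@[simp] lemma freeCounit_tmul (W : RightModule k H) (h : H) (w : W.carrier) :
    freeCounit W (h ⊗ₜ w) = counit (R := k) h • w := by
  simp [freeCounit]

lemma freeCounit_left (W : RightModule k H) (x : H) (t : H ⊗[k] W.carrier) :
    freeCounit W ((LinearMap.mulLeft k x).rTensor W.carrier t) =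
      counit (R := k) x • freeCounit W t := by
  induction t with
  | zero => simp
  | add a b ha hb => simp only [map_add, smul_add, ha, hb]
  | tmul h w => simp [mul_smul]

lemma freeCounit_right (W : RightModule k H) (x : H) (t : H ⊗[k] W.carrier) :
    freeCounit W (diag (LinearMap.mul k H).flip W.rho x t) = W.rho x (freeCounit W t) := by
  rw [freeCounit, LinearMap.comp_apply, rTensor_diag _ _ (counitAction k H) counit
    (fun h u => by simp [counitAction, mul_comm])]
  exact lid_diag W.rho x _

variable {L : Type u} [Ring L] [Bialgebra k L] (g : L →ₐc[k] H)

/-- The reason is h ⊗ w − 1 ⊗ ε(h) w = (h − ε(h))(1 ⊗ w). -/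
lemma mem_span_of_freeCounit_eq_zero (W : RightModule k H) {t : H ⊗[k] W.carrier}
    (ht : freeCounit W t = 0) : t ∈ Submodule.span k {m | ∃ x ∈ {x | counit (R := k) x = 0},
      ∃ n', m = (LinearMap.mulLeft k x).rTensor W.carrier n'} := by
  suffices ∀ t, t - 1 ⊗ₜ[k] freeCounit W t ∈ Submodule.span k
      {m | ∃ x ∈ {x | counit (R := k) x = 0},
        ∃ n', m = (LinearMap.mulLeft k x).rTensor W.carrier n'} by simpa [ht] using this t
  intro t
  induction t with
  | zero => simp
  | add a b ha hb =>
    convert add_mem ha hb using 1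
    rw [map_add, TensorProduct.tmul_add]
    abel
  | tmul h w =>
    refine Submodule.subset_span ⟨h - algebraMap k H (counit (R := k) h), by simp,
      (1 : H) ⊗ₜ[k] w, ?_⟩
    rw [LinearMap.rTensor_tmul, LinearMap.mulLeft_apply, mul_one, TensorProduct.sub_tmul,
      freeCounit_tmul, ← TensorProduct.smul_tmul, Algebra.algebraMap_eq_smul_one]

lemma isCoinvariants_freeCounit (W : RightModule k H) :
    IsCoinvariants (N := ((free W).restrict (AlgHom.id k H) (g : L →ₐ[k] H)).carrier)
      (W := (W.restrict (g : L →ₐ[k] H)).carrier) (fun y : Lᵐᵒᵖ => (1 : H) ⊗ₜ[k] y)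
      {e | ∃ x ∈ {x : H | counit (R := k) x = 0}, e = x ⊗ₜ[k] (1 : Lᵐᵒᵖ)}
      (freeCounit W).toAddMonoidHom :=
  Bimodule.isCoinvariants_left ((free W).restrict (AlgHom.id k H) (g : L →ₐ[k] H))
    (W.restrict (g : L →ₐ[k] H)) {x : H | counit (R := k) x = 0} (freeCounit W)
    (fun w => ⟨(1 : H) ⊗ₜ[k] (show W.carrier from w), (freeCounit_tmul W 1 w).trans (by
      rw [Bialgebra.counit_one]; exact one_smul k _)⟩)
    (fun y n => (congrArg (freeCounit W) (free_right W (g y) n)).trans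
      (freeCounit_right W (g y) n))
    (fun x hx n => (freeCounit_left W x n).trans (by
      rw [show counit (R := k) x = 0 from hx, zero_smul]; rfl))
    (fun _ hn => mem_span_of_freeCounit_eq_zero W hn)

/-- For L-linear f, id ⊗ f respects the diagonal action of L, because `g` carries Δ of L to Δ of H.
-/
lemma dividesMultiple_free {W W' : RightModule k H}
    (h : DividesMultiple Lᵐᵒᵖ (W.restrict (g : L →ₐ[k] H)).carrier
      (W'.restrict (g : L →ₐ[k] H)).carrier) :
    DividesMultiple (H ⊗[k] Lᵐᵒᵖ) ((free W).restrict (AlgHom.id k H) (g : L →ₐ[k] H)).carrier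
      ((free W').restrict (AlgHom.id k H) (g : L →ₐ[k] H)).carrier := by
  obtain ⟨q, a, b, hab⟩ := h.exists_sum_eq_id
  let F {U U' : RightModule k H} (f : (U.restrict (g : L →ₐ[k] H)).carrier →ₗ[Lᵐᵒᵖ]
      (U'.restrict (g : L →ₐ[k] H)).carrier) : U.carrier →ₗ[k] U'.carrier := f.restrictScalars k
  have hF {U U' : RightModule k H} (f : (U.restrict (g : L →ₐ[k] H)).carrier →ₗ[Lᵐᵒᵖ]
      (U'.restrict (g : L →ₐ[k] H)).carrier) (l : L) (t : H ⊗[k] U.carrier) :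
      (F f).lTensor H (diag (LinearMap.mul k H).flip U.rho (g l) t) =
        diag (LinearMap.mul k H).flip U'.rho (g l) ((F f).lTensor H t) := by
    rw [diag_comp, diag_comp]
    exact lTensor_diag _ _ _ _ (fun l u => f.map_smul (op l) u) l t
  let G {U U' : RightModule k H} (f : (U.restrict (g : L →ₐ[k] H)).carrier →ₗ[Lᵐᵒᵖ]
      (U'.restrict (g : L →ₐ[k] H)).carrier) :=
    Bimodule.homMk (M := (free U).restrict (AlgHom.id k H) (g : L →ₐ[k] H))
      (N := (free U').restrict (AlgHom.id k H) (g : L →ₐ[k] H)) ((F f).lTensor H)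
      (fun x m => LinearMap.congr_fun
        ((LinearMap.lTensor_comp_rTensor _ _ _).trans
          (LinearMap.rTensor_comp_lTensor _ _ _).symm) m)
      (fun l m => (congrArg _ (free_right U (g l) m)).trans
        ((hF f l m).trans (free_right U' (g l) _).symm))
  refine .of_sum_eq_id (fun i => G (a i)) (fun i => G (b i)) fun t => ?_
  have key (t : H ⊗[k] W.carrier) :
      ∑ i, (F (b i)).lTensor H ((F (a i)).lTensor H t) = t := by
    induction t with
    | zero => simp
    | add x y hx hy => simp only [map_add, Finset.sum_add_distrib, hx, hy]
    | tmul h w =>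
      simp only [LinearMap.lTensor_tmul, ← TensorProduct.tmul_sum]
      exact congrArg (h ⊗ₜ[k] ·) (hab w)
  exact key t

lemma similar_free_iff {W W' : RightModule k H} :
    Similar (H ⊗[k] Lᵐᵒᵖ) ((free W).restrict (AlgHom.id k H) (g : L →ₐ[k] H)).carrier
      ((free W').restrict (AlgHom.id k H) (g : L →ₐ[k] H)).carrier ↔
    Similar Lᵐᵒᵖ (W.restrict (g : L →ₐ[k] H)).carrier (W'.restrict (g : L →ₐ[k] H)).carrier :=
  ⟨(isCoinvariants_freeCounit g W).similar (isCoinvariants_freeCounit g W'),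
    fun h => ⟨dividesMultiple_free g h.1, dividesMultiple_free g h.2⟩⟩

/-! #### Coinvariants for the right action -/

section RightCoinvariants

variable [FiniteDimensional k H]

/-- The map `H ⊗ W → W`, `h ⊗ w ↦ w S⁻¹(h)`. -/
def freeAntipode (W : RightModule k H) : H ⊗[k] W.carrier →ₗ[k] W.carrier :=
  TensorProduct.lift (W.rho ∘ₗ (antipodeEquiv k H).symm.toLinearMap)

@[simp] lemma freeAntipode_tmul (W : RightModule k H) (h : H) (w : W.carrier) :
    freeAntipode W (h ⊗ₜ w) = W.rho ((antipodeEquiv k H).symm h) w := rfl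

/-- S⁻¹(S(x) h) = S⁻¹(h) x: twisting by S converts the left action into a right one, and R need only
be stable under S, not S⁻¹. -/
lemma freeAntipode_left (W : RightModule k H) (x : H) (t : H ⊗[k] W.carrier) :
    freeAntipode W ((LinearMap.mulLeft k (antipode k x)).rTensor W.carrier t) =
      W.rho x (freeAntipode W t) := by
  induction t with
  | zero => simp
  | add a b ha hb => simp only [map_add, ha, hb]
  | tmul h w => simp [antipodeEquiv_symm_mul, RightModule.rho_mul_apply]

/-- The factor ∑ x₂ S⁻¹(x₁) = ε(x) appears between w and S⁻¹(h). -/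
lemma freeAntipode_right (W : RightModule k H) (x : H) (t : H ⊗[k] W.carrier) :
    freeAntipode W (diag (LinearMap.mul k H).flip W.rho x t) =
      counit (R := k) x • freeAntipode W t := by
  induction t with
  | zero => simp
  | add a b ha hb => simp only [map_add, smul_add, ha, hb]
  | tmul h w =>
    rw [diag_tmul, ← (ℛ k x).eq]
    simp only [map_sum, TensorProduct.map_tmul, freeAntipode_tmul, LinearMap.flip_apply,
      LinearMap.mul_apply', antipodeEquiv_symm_mul, ← RightModule.rho_mul_apply, ← mul_assoc]
    rw [← LinearMap.sum_apply, ← map_sum, ← Finset.sum_mul, sum_mul_antipodeEquiv_symm]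
    simp

/-- The left side expands to ∑ h₁ ⊗ w S⁻¹(h₃) h₂, and S⁻¹(h₃) h₂ collapses to a counit. -/
lemma sum_diag_antipodeEquiv_symm (W : RightModule k H) (h : H) (w : W.carrier) :
    ∑ i ∈ (ℛ k h).index, diag (LinearMap.mul k H).flip W.rho ((ℛ k h).left i)
      (1 ⊗ₜ[k] W.rho ((antipodeEquiv k H).symm ((ℛ k h).right i)) w) = h ⊗ₜ[k] w := by
  let B : H ⊗[k] H →ₗ[k] W.carrier := TensorProduct.lift
    (((LinearMap.mul k H).flip.compr₂ (W.rho.flip w)).compl₂ (antipodeEquiv k H).symm.toLinearMap)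
  have hB (b c : H) : B (b ⊗ₜ c) = W.rho ((antipodeEquiv k H).symm c * b) w := rfl
  have h₁ (a c : H) : diag (LinearMap.mul k H).flip W.rho a
      (1 ⊗ₜ[k] W.rho ((antipodeEquiv k H).symm c) w) =
      B.lTensor H (TensorProduct.assoc k H H H (comul a ⊗ₜ c)) := by
    rw [diag_tmul]
    generalize (comul a : H ⊗[k] H) = s
    induction s with
    | zero => simp
    | add x y hx hy => simp only [map_add, TensorProduct.add_tmul, hx, hy]
    | tmul x y => simp [hB, RightModule.rho_mul_apply]
  have h₂ (b : H) : B (comul b) = counit (R := k) b • w := by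
    rw [← (ℛ k b).eq]
    simp only [map_sum, hB]
    rw [← LinearMap.sum_apply, ← map_sum, sum_antipodeEquiv_symm_mul]
    simp [RightModule.rho_one_apply]
  have h₃ : B ∘ₗ comul = (LinearMap.toSpanSingleton k W.carrier w) ∘ₗ counit :=
    LinearMap.ext h₂
  simp only [h₁, ← LinearMap.rTensor_tmul]
  rw [← map_sum, ← map_sum, ← map_sum, (ℛ k h).eq, coassoc_apply, ← LinearMap.comp_apply,
    ← LinearMap.lTensor_comp, h₃, LinearMap.lTensor_comp, LinearMap.comp_apply,
    lTensor_counit_comul]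
  simp

/-- Subtracting from h ⊗ w = ∑ (1 ⊗ w S⁻¹(h₂)) h₁ the same sum with ε(h₁) acting in place of h₁
leaves 1 ⊗ w S⁻¹(h) removed and only elements h₁ − ε(h₁) of H⁺ acting. -/
lemma mem_span_of_freeAntipode_eq_zero (W : RightModule k H) {t : H ⊗[k] W.carrier}
    (ht : freeAntipode W t = 0) : t ∈ Submodule.span k {m | ∃ x ∈ {x | counit (R := k) x = 0},
      ∃ n', m = diag (LinearMap.mul k H).flip W.rho x n'} := by
  suffices ∀ t, t - 1 ⊗ₜ[k] freeAntipode W t ∈ Submodule.span k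
      {m | ∃ x ∈ {x | counit (R := k) x = 0},
        ∃ n', m = diag (LinearMap.mul k H).flip W.rho x n'} by simpa [ht] using this t
  intro t
  induction t with
  | zero => simp
  | add a b ha hb =>
    convert add_mem ha hb using 1
    rw [map_add, TensorProduct.tmul_add]
    abel
  | tmul h w =>
    have h₁ : (1 : H) ⊗ₜ[k] freeAntipode W (h ⊗ₜ w) = ∑ i ∈ (ℛ k h).index,
        diag (LinearMap.mul k H).flip W.rho (algebraMap k H (counit (R := k) ((ℛ k h).left i)))
          (1 ⊗ₜ[k] W.rho ((antipodeEquiv k H).symm ((ℛ k h).right i)) w) := by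
      have (c : k) (t : H ⊗[k] W.carrier) :
          diag (LinearMap.mul k H).flip W.rho (algebraMap k H c) t = c • t := by
        rw [Algebra.algebraMap_eq_smul_one, map_smul, LinearMap.smul_apply, ← free_right]
        exact congrArg (c • ·) (by rw [op_one, map_one]; rfl)
      conv_lhs => rw [freeAntipode_tmul, ← sum_counit_smul (ℛ k h)]
      simp only [this, map_sum, map_smul, LinearMap.sum_apply, LinearMap.smul_apply,
        TensorProduct.tmul_sum, TensorProduct.tmul_smul]
    rw [h₁, ← sum_diag_antipodeEquiv_symm W h w, ← Finset.sum_sub_distrib]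
    refine sum_mem fun i _ => Submodule.subset_span
      ⟨(ℛ k h).left i - algebraMap k H (counit (R := k) ((ℛ k h).left i)), by simp,
        1 ⊗ₜ[k] W.rho ((antipodeEquiv k H).symm ((ℛ k h).right i)) w, ?_⟩
    rw [map_sub, LinearMap.sub_apply]

lemma isCoinvariants_freeAntipode (R : HopfSubalgebra k H) (W : RightModule k H) :
    IsCoinvariants (N := ((free W).restrict R.toSubalgebra.val (AlgHom.id k H)).carrier)
      (W := (W.restrict R.toSubalgebra.val).carrier)
      (fun l : R.toSubalgebraᵐᵒᵖ =>
        (⟨antipode k (l.unop : H), R.antipode_mem _ l.unop.2⟩ : R.toSubalgebra) ⊗ₜ[k] (1 : Hᵐᵒᵖ))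
      {e | ∃ x ∈ {x : H | counit (R := k) x = 0}, e = (1 : R.toSubalgebra) ⊗ₜ[k] op x}
      (freeAntipode W).toAddMonoidHom :=
  Bimodule.isCoinvariants_right ((free W).restrict R.toSubalgebra.val (AlgHom.id k H))
    (W.restrict R.toSubalgebra.val)
    (fun l => (⟨antipode k (l : H), R.antipode_mem _ l.2⟩ : R.toSubalgebra))
    {x : H | counit (R := k) x = 0} (freeAntipode W)
    (fun w => ⟨(1 : H) ⊗ₜ[k] (show W.carrier from w), (freeAntipode_tmul W 1 w).trans (by
      rw [antipodeEquiv_symm_one]; exact W.rho_one_apply w)⟩)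
    (fun r n => freeAntipode_left W r n)
    (fun x hx n => (congrArg (freeAntipode W) (free_right W x n)).trans
      ((freeAntipode_right W x n).trans (by
        rw [show counit (R := k) x = 0 from hx, zero_smul]; rfl)))
    (fun n hn => by
      have := mem_span_of_freeAntipode_eq_zero W hn
      simp only [← free_right] at this
      exact this)

end RightCoinvariants

/-! #### Coinvariants for the left action of a Hopf subalgebra -/

namespace HopfSubalgebra

variable (R : HopfSubalgebra k H)

lemma mem_span_of_rTensor_proj_eq_zero (W : RightModule k H) {t : H ⊗[k] W.carrier}
    (ht : R.proj.rTensor W.carrier t = 0) : t ∈ Submodule.span k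
      {m | ∃ x ∈ {x : R.toSubalgebra | counit (R := k) (x : H) = 0},
        ∃ n', m = (LinearMap.mulLeft k (x : H)).rTensor W.carrier n'} := by
  have hexact : Function.Exact (R.augIdeal.restrictScalars k).subtype R.proj := fun y => by
    rw [proj_eq_zero_iff]
    simp
  obtain ⟨z, rfl⟩ := (rTensor_exact W.carrier hexact R.proj_surjective _).1 ht
  clear ht
  induction z with
  | zero => simp
  | add a b ha hb => simpa only [map_add] using add_mem ha hb
  | tmul a w =>
    rw [LinearMap.rTensor_tmul]
    refine R.augIdeal_induction (p := fun a => a ⊗ₜ[k] w ∈ Submodule.span k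
      {m | ∃ x ∈ {x : R.toSubalgebra | counit (R := k) (x : H) = 0},
        ∃ n', m = (LinearMap.mulLeft k (x : H)).rTensor W.carrier n'})
      (by simp) (fun a b ha hb => ?_) (fun r hr h0 h => ?_) a.2
    · rw [TensorProduct.add_tmul]
      exact add_mem ha hb
    · exact Submodule.subset_span ⟨⟨r, hr⟩, h0, h ⊗ₜ w, by simp⟩

lemma isCoinvariants_proj (W : RightModule k H) :
    IsCoinvariants (N := ((free W).restrict R.toSubalgebra.val R.toSubalgebra.val).carrier)
      (W := ((R.permModule.tensor W).restrict R.toSubalgebra.val).carrier)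
      (fun y : R.toSubalgebraᵐᵒᵖ => (1 : R.toSubalgebra) ⊗ₜ[k] y)
      {e | ∃ x ∈ {x : R.toSubalgebra | counit (R := k) (x : H) = 0},
        e = x ⊗ₜ[k] (1 : R.toSubalgebraᵐᵒᵖ)}
      (R.proj.rTensor W.carrier).toAddMonoidHom :=
  Bimodule.isCoinvariants_left ((free W).restrict R.toSubalgebra.val R.toSubalgebra.val)
    ((R.permModule.tensor W).restrict R.toSubalgebra.val)
    {x : R.toSubalgebra | counit (R := k) (x : H) = 0} (R.proj.rTensor W.carrier)
    (LinearMap.rTensor_surjective _ R.proj_surjective)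
    (fun y n => (congrArg (R.proj.rTensor W.carrier) (free_right W y n)).trans <|
      (rTensor_diag _ _ R.permModule.rho R.proj (fun h u => R.proj_mul u h) (y : H) n).trans
        (RightModule.tensor_act R.permModule W y _).symm)
    (fun x hx n => by
      have key (t : H ⊗[k] W.carrier) :
          R.proj.rTensor W.carrier ((LinearMap.mulLeft k (x : H)).rTensor W.carrier t) = 0 := by
        rw [← LinearMap.comp_apply, ← LinearMap.rTensor_comp]
        have : R.proj ∘ₗ LinearMap.mulLeft k (x : H) = 0 := LinearMap.ext fun h => by
          rw [LinearMap.comp_apply, LinearMap.mulLeft_apply, R.proj_mul_left x.2,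
            show counit (R := k) (x : H) = 0 from hx, zero_smul, LinearMap.zero_apply]
        rw [this, LinearMap.rTensor_zero, LinearMap.zero_apply]
      exact key n)
    (fun _ hn => R.mem_span_of_rTensor_proj_eq_zero W hn)

/-- Needed for depth one, where the lower tensor power is R itself and not of the form H ⊗ W. -/
lemma isCoinvariants_counit :
    IsCoinvariants (N := (Bimodule.regular k R.toSubalgebra).carrier)
      (W := ((RightModule.unit k H).restrict R.toSubalgebra.val).carrier)
      (fun y : R.toSubalgebraᵐᵒᵖ => (1 : R.toSubalgebra) ⊗ₜ[k] y)
      {e | ∃ x ∈ {x : R.toSubalgebra | counit (R := k) (x : H) = 0},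
        e = x ⊗ₜ[k] (1 : R.toSubalgebraᵐᵒᵖ)}
      (counit (R := k) ∘ₗ R.toSubalgebra.val.toLinearMap).toAddMonoidHom :=
  Bimodule.isCoinvariants_left (Bimodule.regular k R.toSubalgebra)
    ((RightModule.unit k H).restrict R.toSubalgebra.val)
    {x : R.toSubalgebra | counit (R := k) (x : H) = 0}
    (counit (R := k) ∘ₗ R.toSubalgebra.val.toLinearMap)
    (fun c => ⟨algebraMap k R.toSubalgebra c, Bialgebra.counit_algebraMap (R := k) (A := H) c⟩)
    (fun (y n : R.toSubalgebra) => (Bialgebra.counit_mul (R := k) (n : H) (y : H)).trans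
      ((mul_comm _ _).trans (RightModule.unit_act (y : H) (counit (R := k) (n : H))).symm))
    (fun (x : R.toSubalgebra) hx (n : R.toSubalgebra) =>
      (Bialgebra.counit_mul (R := k) (x : H) (n : H)).trans (by
        rw [show counit (R := k) (x : H) = 0 from hx, zero_mul]; rfl))
    (fun (n : R.toSubalgebra) hn =>
      Submodule.subset_span ⟨n, hn, (1 : R.toSubalgebra), (mul_one n).symm⟩)

end HopfSubalgebra

end FreeBimodule

/-! ### Comparison of the depths -/

section Comparison

variable {k : Type u} [Field k]

namespace RightModule

variable {H : Type u} [Ring H] [Bialgebra k H]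

/-- The tensor product of an isomorphism with a module. -/
def rTensorEquiv {U U' : RightModule k H} (e : U.carrier ≃ₗ[Hᵐᵒᵖ] U'.carrier)
    (W : RightModule k H) : (U.tensor W).carrier ≃ₗ[Hᵐᵒᵖ] (U'.tensor W).carrier :=
  .ofBijective (homMk (U := U.tensor W) (W := U'.tensor W)
    ((e.restrictScalars k).toLinearMap.rTensor W.carrier) fun h t =>
      (congrArg _ (tensor_act U W h t)).trans <|
        (rTensor_diag U.rho W.rho U'.rho (e.restrictScalars k).toLinearMap
          (fun x w => e.map_smul (op x) w) h t).trans (tensor_act U' W h _).symm)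
    (TensorProduct.congr (e.restrictScalars k) (LinearEquiv.refl k W.carrier)).bijective

/-- Prepending a tensor factor to a tensor power is the same as appending one. -/
lemma nonempty_tensor_tpow_equiv (W : RightModule k H) (n : ℕ) :
    Nonempty ((W.tensor (W.tpow n)).carrier ≃ₗ[Hᵐᵒᵖ] (W.tpow (n + 1)).carrier) := by
  induction n with
  | zero =>
    let e₁ := LinearEquiv.ofBijective W.ridHom (TensorProduct.rid k W.carrier).bijective
    let e₂ := LinearEquiv.ofBijective W.lidHom (TensorProduct.lid k W.carrier).bijective
    exact ⟨e₁.trans e₂.symm⟩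
  | succ n ih =>
    obtain ⟨e⟩ := ih
    let a := LinearEquiv.ofBijective (W.assocInvHom (W.tpow n) W)
      (TensorProduct.assoc k W.carrier (W.tpow n).carrier W.carrier).symm.bijective
    exact ⟨a.trans (rTensorEquiv e W)⟩

end RightModule

variable {H : Type u} [Ring H] [HopfAlgebra k H]

namespace HopfSubalgebra

variable (R : HopfSubalgebra k H)

lemma hasRightDepth_iff (n : ℕ) : HasRightDepth R.toSubalgebra n ↔
    (R.permModule.restrict R.toSubalgebra.val).HasModuleDepth n :=
  (similar_congr ((R.tensorPowerIso (n + 1)).restrict (AlgHom.id k H)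
    R.toSubalgebra.val).toLinearEquiv ((R.tensorPowerIso n).restrict (AlgHom.id k H)
      R.toSubalgebra.val).toLinearEquiv).trans
        ((similar_free_iff R.incl).trans (R.hasModuleDepth_restrict_iff n).symm)

lemma similar_tensorPower_iff (n : ℕ) : Similar (H ⊗[k] Hᵐᵒᵖ)
    (tensorPower R.toSubalgebra (n + 1)).carrier (tensorPower R.toSubalgebra n).carrier ↔
      R.permModule.HasModuleDepth n :=
  (similar_congr (R.tensorPowerIso (n + 1)).toLinearEquiv
    (R.tensorPowerIso n).toLinearEquiv).trans
      ((similar_free_iff (BialgHom.id k H)).trans (R.hasModuleDepth_iff n).symm)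

lemma hasModuleDepth_of_hasLeftDepth [FiniteDimensional k H] {n : ℕ}
    (h : HasLeftDepth R.toSubalgebra n) :
    (R.permModule.restrict R.toSubalgebra.val).HasModuleDepth n := by
  rw [hasModuleDepth_restrict_iff]
  refine (isCoinvariants_freeAntipode R _).similar (isCoinvariants_freeAntipode R _) ?_
  exact (similar_congr ((R.tensorPowerIso (n + 1)).restrict R.toSubalgebra.val
    (AlgHom.id k H)).toLinearEquiv ((R.tensorPowerIso n).restrict R.toSubalgebra.val
      (AlgHom.id k H)).toLinearEquiv).1 h

lemma similar_tensor_tpow (n : ℕ) : Similar R.toSubalgebraᵐᵒᵖ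
    ((R.permModule.tensor (R.permModule.tpow n)).restrict R.toSubalgebra.val).carrier
    ((R.permModule.tpow (n + 1)).restrict R.toSubalgebra.val).carrier := by
  obtain ⟨e⟩ := R.permModule.nonempty_tensor_tpow_equiv n
  exact ⟨RightModule.dividesMultiple_restrict (.of_equiv e) _,
    RightModule.dividesMultiple_restrict (.of_equiv e.symm) _⟩

/-- Killing R⁺ on the left adds one factor V to H ⊗ V^{⊗m}. This compensates for the odd condition
comparing m = n with m = n − 1. -/
lemma hasModuleDepth_of_hasOddDepth {n : ℕ} (h : HasOddDepth R.toSubalgebra n) :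
    (R.permModule.restrict R.toSubalgebra.val).HasModuleDepth n := by
  rw [hasModuleDepth_restrict_iff]
  let e (m : ℕ) := ((R.tensorPowerIso m).restrict R.toSubalgebra.val
    R.toSubalgebra.val).toLinearEquiv
  cases n with
  | zero =>
    refine (R.similar_tensor_tpow 0).symm.trans
      ((R.isCoinvariants_proj _).similar R.isCoinvariants_counit ?_)
    exact (similar_congr (e 0) (LinearEquiv.refl _ _)).1 h
  | succ n =>
    refine ((R.similar_tensor_tpow (n + 1)).symm.trans
      ((R.isCoinvariants_proj _).similar (R.isCoinvariants_proj _) ?_)).trans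
        (R.similar_tensor_tpow n)
    exact (similar_congr (e (n + 1)) (e n)).1 h

end HopfSubalgebra

/-- An infimum of natural numbers is infinite or attained. -/
lemma iInf_natCast_eq (Q : ℕ → Prop) :
    ⨅ (n : ℕ) (_ : Q n), (n : ℕ∞) = ⊤ ∨
      ∃ d, Q d ∧ ⨅ (n : ℕ) (_ : Q n), (n : ℕ∞) = d := by
  classical
  by_cases h : ∃ n, Q n
  · refine .inr ⟨Nat.find h, Nat.find_spec h, le_antisymm ?_ ?_⟩
    · exact iInf₂_le _ (Nat.find_spec h)
    · exact le_iInf₂ fun n hn => by exact_mod_cast Nat.find_min' h hn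
  · push Not at h
    exact .inl (by simp [h])

/-- An even number that is at least 2d + 1 is at least 2d + 2. -/
lemma minEvenDepth_of_bounds {A : Type u} [Ring A] [Algebra k A] {B : Subalgebra k A} {d : ℕ∞}
    (h₁ : 2 * d + 1 ≤ minDepth B) (h₂ : minDepth B ≤ 2 * d + 2) :
    minEvenDepth B = 2 * d + 2 := by
  refine le_antisymm (sInf_le ⟨?_, h₂⟩) (le_sInf ?_)
  · exact ⟨d + 1, by ring⟩
  · rintro m ⟨⟨r, rfl⟩, hm⟩
    have h := h₁.trans hm
    cases r using ENat.recTopCoe with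
    | top => simp
    | coe r =>
      cases d using ENat.recTopCoe with
      | top => simp at h
      | coe d =>
        norm_cast at h ⊢
        omega

end Comparison

end HopfDepth

end

theorem mainTheorem1 {k : Type u} [Field k] {H : Type u} [Ring H] [HopfAlgebra k H]
    [FiniteDimensional k H] (R : HopfDepth.HopfSubalgebra k H) :
    HopfDepth.minEvenDepth R.toSubalgebra =
        2 * (R.permModule.restrict R.toSubalgebra.val).depth + 2 ∧
      HopfDepth.minHDepth R.toSubalgebra = 2 * R.permModule.depth + 1 ∧
      2 * (R.permModule.restrict R.toSubalgebra.val).depth + 1 ≤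
        HopfDepth.minDepth R.toSubalgebra ∧
      HopfDepth.minDepth R.toSubalgebra ≤
        2 * (R.permModule.restrict R.toSubalgebra.val).depth + 2 := by
  have lower : 2 * (R.permModule.restrict R.toSubalgebra.val).depth + 1 ≤
      HopfDepth.minDepth R.toSubalgebra := by
    have hd {n : ℕ} (h : (R.permModule.restrict R.toSubalgebra.val).HasModuleDepth n) :
        (R.permModule.restrict R.toSubalgebra.val).depth ≤ n := iInf₂_le n h
    refine le_iInf₂ fun d h => ?_
    rcases h with ⟨n, rfl, h⟩ | ⟨n, rfl, h | h⟩
    · push_cast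
      gcongr
      exact hd (R.hasModuleDepth_of_hasOddDepth h)
    -- Even depth 2n + 2 already gives module depth n, so one unit can be discarded.
    · refine le_trans (b := ((2 * n + 1 : ℕ) : ℕ∞)) ?_ (by gcongr; omega)
      push_cast
      gcongr
      exact hd (R.hasModuleDepth_of_hasLeftDepth h)
    · refine le_trans (b := ((2 * n + 1 : ℕ) : ℕ∞)) ?_ (by gcongr; omega)
      push_cast
      gcongr
      exact hd ((R.hasRightDepth_iff n).1 h)
  have upper : HopfDepth.minDepth R.toSubalgebra ≤
      2 * (R.permModule.restrict R.toSubalgebra.val).depth + 2 := by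
    rcases HopfDepth.iInf_natCast_eq
      (R.permModule.restrict R.toSubalgebra.val).HasModuleDepth with h | ⟨d, hd, h⟩
    · rw [HopfDepth.RightModule.depth, h]
      simp
    · rw [HopfDepth.RightModule.depth, h]
      -- Module depth d over R is attained as right depth 2(d + 1).
      refine (iInf₂_le (2 * (d + 1))
        (.inr ⟨d, rfl, .inr ((R.hasRightDepth_iff d).2 hd)⟩)).trans_eq ?_
      push_cast
      ring
  refine ⟨HopfDepth.minEvenDepth_of_bounds lower upper, le_antisymm ?_ ?_, lower, upper⟩
  · rcases HopfDepth.iInf_natCast_eq R.permModule.HasModuleDepth with h | ⟨d, hd, h⟩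
    · rw [HopfDepth.RightModule.depth, h]
      simp
    · rw [HopfDepth.RightModule.depth, h]
      refine (iInf₂_le (2 * d + 1) ⟨d, rfl, (R.similar_tensorPower_iff d).2 hd⟩).trans_eq ?_
      push_cast
      rfl
  · refine le_iInf₂ fun d h => ?_
    obtain ⟨n, rfl, h⟩ := h
    push_cast
    gcongr
    exact iInf₂_le n ((R.similar_tensorPower_iff n).1 h)
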